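/- **Setting.** Let $N\ge 1$, $\mathcal I=\{1,\dots,N\}$, $n=\sum_i n_i$, and write $\boldsymbol x=(x_i,\boldsymbol x_{-i})\in\mathbb R^n$ with $x_i\in\mathbb R^{n_i}$. Let $\Omega_i\subseteq\mathbb R^{n_i}$, $\boldsymbol\Omega=\prod_i\Omega_i$, $A_i\in\mathbb R^{m\times n_i}$, $b_i\in\mathbb R^m$, $A=[A_1,\dots,A_N]$, $b=\sum_i b_i$, and let $\xi$ be an $\mathbb R^d$-valued random variable on a probability space $(\Xi,\mathcal F,\mathbb P)$. For measurable $J_i:\mathbb R^n\times\mathbb R^d\to\mathbb R$ put $\mathbb J_i(\boldsymbol x)=\mathbb E[J_i(\boldsymbol x,\xi)]$, $\mathbb F(\boldsymbol x)=\operatorname{col}\big(\mathbb E[\nabla_{x_i}J_i(\boldsymbol x,\xi)]\big)_{i\in\mathcal I}$, $\boldsymbol{\mathcal X}=\{\boldsymbol x\in\boldsymbol\Omega: A\boldsymbol x\le b\}$ and $\mathcal X_i(\boldsymbol x_{-i})=\{y\in\Omega_i: A_iy\le b-\sum_{j\ne i}A_jx_j\}$. A point $\boldsymbol x^*\in\boldsymbol{\mathcal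 X}$ is a stochastic generalized Nash equilibrium (SGNE) if $\mathbb J_i(x_i^*,\boldsymbol x_{-i}^*)\le\mathbb J_i(y,\boldsymbol x_{-i}^*)$ for all $i$ and all $y\in\mathcal X_i(\boldsymbol x^*_{-i})$. It solves $\mathrm{SVI}(\boldsymbol{\mathcal X},\mathbb F)$ if $\langle\mathbb F(\boldsymbol x^*),\boldsymbol x-\boldsymbol x^*\rangle\ge0$ for all $\boldsymbol x\in\boldsymbol{\mathcal X}$. A variational SGNE (v-SGNE) is an SGNE that solves $\mathrm{SVI}(\boldsymbol{\mathcal X},\mathbb F)$. **Assumptions.** 1. *Costs.* $J_i(\boldsymbol x,\xi)$ is integrable for every $\boldsymbol x\in\boldsymbol\Omega$, and $\nabla_{x_i}J_i(\boldsymbol x,\xi)$ is integrable for every $\boldsymbol x\in\mathbb R^n$. For every $\boldsymbol x_{-i}\in\prod_{j\ne i}\Omega_j$, the function $\mathbb J_i(\cdot,\boldsymbol x_{-i})$ is convex and continuously differentiable on $\Omega_i$; for every $v\in\mathbb R^d$, $J_i(\cdot,\boldsymbol x_{-i},v)$ is convex on $\Omega_i$ and Lipschitz continuous on $\Omega_i$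 with a constant $\ell_i(\boldsymbol x_{-i},v)$ such that $\ell_i(\boldsymbol x_{-i},\xi)$ is integrable. Moreover $J_i(\cdot,\boldsymbol x_{-i},v)$ is continuously differentiable on $\mathbb R^{n_i}$ for all $\boldsymbol x_{-i}$ and $v$. 2. *Constraints.* Each $\Omega_i$ is nonempty, compact and convex, and Slater's condition holds: there is $\boldsymbol x\in\boldsymbol\Omega$ with $A\boldsymbol x<b$ componentwise. 3. *Graph.* $W=(w_{i,j})$ is the weighted adjacency matrix of an undirected connected graph on $\mathcal I$: $w_{i,j}=w_{j,i}\ge0$, $w_{i,i}=0$, and $i\neq j$ are adjacent iff $w_{i,j}>0$. 4. *Monotonicity.* $\mathbb F$ is monotone and $\ell_{\mathbb F}$-Lipschitz continuous on $\mathbb R^n$ for some $\ell_{\mathbb F}>0$. 5. *Uniqueness.* $\mathrm{SVI}(\boldsymbol{\mathcal X},\mathbb F)$ has exactly one solution. **Algorithm.** Let $(\mathbf L\boldsymbol u)_i=\sum_j w_{i,j}(u_i-u_j)$ for $\boldsymbol u\in(\mathbb R^m)^N$. The (possibly random) initial data satisfy $x_i^0\in\Omega_i$, $\lambda_i^0\in\mathbb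 R^m_{\ge0}$, $z_i^0\in\mathbb R^m$, while $\boldsymbol x^{-1},\boldsymbol z^{-1},\boldsymbol\lambda^{-1}$ are arbitrary. For $k\ge0$ put $\tilde{\boldsymbol x}^k=2\boldsymbol x^k-\boldsymbol x^{k-1}$, $\tilde{\boldsymbol z}^k=2\boldsymbol z^k-\boldsymbol z^{k-1}$, $\tilde{\boldsymbol\lambda}^k=2\boldsymbol\lambda^k-\boldsymbol\lambda^{k-1}$ and, for every $i$, $$\begin{aligned} x_i^{k+1}&=\operatorname{proj}_{\Omega_i}\big[x_i^k-\alpha_i\big(F_i^{\rm SA}(\tilde{\boldsymbol x}^k,\boldsymbol\xi^k)+A_i^\top\tilde\lambda_i^k\big)\big],\\ z_i^{k+1}&=z_i^k-\nu_i\sum_j w_{i,j}(\tilde\lambda_i^k-\tilde\lambda_j^k),\\ \lambda_i^{k+1}&=\operatorname{proj}_{\mathbb R^m_{\ge0}}\Big[\lambda_i^k+\tau_i(A_i\tilde x_i^k-b_i)+\tau_i\sum_j w_{i,j}\big((\tilde z_i^k-\tilde z_j^k)-(\tilde\lambda_i^k-\tilde\lambda_j^k)\big)\Big], \end{aligned}$$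 where $F_i^{\rm SA}(\boldsymbol x,\boldsymbol\xi^k)=\frac1{N_k}\sum_{s=1}^{N_k}\nabla_{x_i}J_i(\boldsymbol x,\xi_i^{k,(s)})$. The samples $\xi_i^{k,(s)}$ have the law of $\xi$, and the families $(\xi_i^{k,(s)})_{i\in\mathcal I}$ are independent over the pairs $(k,s)$, $1\le s\le N_k$. The step sizes satisfy $0<\alpha_i,\nu_i,\tau_i$ and $\alpha_i\ell_{\mathcal A},\ \nu_i\ell_{\mathcal A},\ \tau_i\ell_{\mathcal A}<\sqrt2-1$ for all $i$, where $\ell_{\mathcal A}$ is the best Lipschitz constant (for the Euclidean norm) of $$\mathcal A(\boldsymbol x,\boldsymbol z,\boldsymbol\lambda)=\big(\mathbb F(\boldsymbol x)+\mathbf A^\top\boldsymbol\lambda,\ \mathbf L\boldsymbol\lambda,\ \mathbf L\boldsymbol\lambda+\operatorname{col}(b_1,\dots,b_N)-\mathbf A\boldsymbol x-\mathbf L\boldsymbol z\big),\qquad \mathbf A=\operatorname{diag}(A_1,\dots,A_N).$$ **Batch sizes and errors.** There are $c,k_0,a>0$ with $N_k\ge c(k+k_0)^{a+1}$ for all $k\ge0$.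 Let $\mathcal F_k$ be the $\sigma$-algebra generated by the initial data and all samples drawn at iterations $0,\dots,k-1$, and let $\epsilon^k=F^{\rm SA}(\tilde{\boldsymbol x}^k,\boldsymbol\xi^k)-\mathbb F(\tilde{\boldsymbol x}^k)$. Then $\epsilon^k$ is square integrable, $\mathbb E[\epsilon^k\mid\mathcal F_k]=0$ a.s., and there are $C,\sigma>0$ with $\mathbb E[\|\epsilon^k\|^2\mid\mathcal F_k]\le C\sigma^2/N_k$ a.s. for all $k$. **Theorem.** Under these assumptions there is a v-SGNE $\boldsymbol x^*$ of the game such that $\boldsymbol x^k\to\boldsymbol x^*$ almost surely. -/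

import Mathlib

open MeasureTheory ProbabilityTheory Filter Topology
open scoped RealInnerProductSpace NNReal

namespace SGNEP

noncomputable section

/-- The space `ℝⁿ`, `n = ∑ i, n i`, of collective decisions `x = col (x₁, …, x_N)`, with `x i ∈ ℝ^{n i}`
and the Euclidean norm. -/
abbrev Profile {N : ℕ} (n : Fin N → ℕ) : Type := PiLp 2 (fun i => EuclideanSpace ℝ (Fin (n i)))

/-- The space `ℝ^{Nm}` of stacked dual (or auxiliary) variables, with the Euclidean norm. -/
abbrev Dual (N m : ℕ) : Type := PiLp 2 (fun _ : Fin N => EuclideanSpace ℝ (Fin m))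

/-- The space of triples `ω = col (x, z, λ)`, with the Euclidean norm. -/
abbrev State {N : ℕ} (n : Fin N → ℕ) (m : ℕ) : Type :=
  WithLp 2 (Profile n × WithLp 2 (Dual N m × Dual N m))

namespace State

variable {N : ℕ} {n : Fin N → ℕ} {m : ℕ}

/-- The triple `col (x, z, λ)`. -/
def mk (x : Profile n) (z l : Dual N m) : State n m := WithLp.toLp 2 (x, WithLp.toLp 2 (z, l))

/-- The primal block `x`. -/
def primal (w : State n m) : Profile n := w.fst

/-- The auxiliary block `z`. -/
def aux (w : State n m) : Dual N m := w.snd.fst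

/-- The dual block `λ`. -/
def dual (w : State n m) : Dual N m := w.snd.snd

end State

/-- The Euclidean projection onto `C`: a minimizer over `p ∈ C` of `‖p - v‖` (it exists and is
unique when `C` is nonempty, closed and convex, the only case in which it is used). -/
def proj {E : Type*} [NormedAddCommGroup E] (C : Set E) (v : E) : E :=
  Classical.epsilon fun p => p ∈ C ∧ ∀ q ∈ C, ‖p - v‖ ≤ ‖q - v‖

/-- The nonnegative orthant `ℝ^m_{≥0}`. -/
def orthant (m : ℕ) : Set (EuclideanSpace ℝ (Fin m)) := {v | ∀ r, 0 ≤ v r}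

/-- The vector `(y, x_{-i})`: the block `x i` is replaced by `y`. -/
def replace {N : ℕ} {n : Fin N → ℕ} (x : Profile n) (i : Fin N)
    (y : EuclideanSpace ℝ (Fin (n i))) : Profile n :=
  WithLp.toLp 2 (Function.update x.ofLp i y)

/-- The data of the game: local decision sets `Ω i ⊆ ℝ^{n i}`, scenario costs
`J i : ℝⁿ × ℝ^d → ℝ`, and the shared affine constraints `∑ i, A i x i ≤ ∑ i, b i` in `ℝ^m`, in which
agent `i` knows `A i` and `b i`. -/
structure Game {N : ℕ} (n : Fin N → ℕ) (m d : ℕ) where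
  Ω : (i : Fin N) → Set (EuclideanSpace ℝ (Fin (n i)))
  J : Fin N → Profile n → EuclideanSpace ℝ (Fin d) → ℝ
  A : (i : Fin N) → Matrix (Fin m) (Fin (n i)) ℝ
  b : Fin N → EuclideanSpace ℝ (Fin m)

namespace Game

variable {N : ℕ} {n : Fin N → ℕ} {m d : ℕ} (G : Game n m d)

/-- The product `A i y ∈ ℝ^m`. -/
def mulA (i : Fin N) (y : EuclideanSpace ℝ (Fin (n i))) : EuclideanSpace ℝ (Fin m) :=
  Matrix.toEuclideanLin (G.A i) y

/-- The product `(A i)ᵀ l ∈ ℝ^{n i}`. -/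
def mulAT (i : Fin N) (l : EuclideanSpace ℝ (Fin m)) : EuclideanSpace ℝ (Fin (n i)) :=
  Matrix.toEuclideanLin (G.A i).transpose l

/-- The product `∏ i, Ω i` of the local decision sets. -/
def localSet : Set (Profile n) := {x | ∀ i, x i ∈ G.Ω i}

/-- The collective feasible set `𝓧 = {x ∈ ∏ i, Ω i | A x ≤ b}`. -/
def feasible : Set (Profile n) :=
  {x | x ∈ G.localSet ∧ ∀ r, (∑ i, G.mulA i (x i)) r ≤ (∑ i, G.b i) r}

/-- The feasible set of agent `i`: `𝓧_i(x_{-i}) = {y ∈ Ω i | A_i y ≤ b - ∑_{j ≠ i} A_j x_j}`. -/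
def feasibleFor (i : Fin N) (x : Profile n) : Set (EuclideanSpace ℝ (Fin (n i))) :=
  {y | y ∈ G.Ω i ∧
    ∀ r, G.mulA i y r ≤ (∑ j, G.b j) r - (∑ j ∈ Finset.univ.erase i, G.mulA j (x j)) r}

/-- The partial gradient `∇_{x_i} J_i(x, v)`. -/
def gradJ (i : Fin N) (x : Profile n) (v : EuclideanSpace ℝ (Fin d)) :
    EuclideanSpace ℝ (Fin (n i)) :=
  gradient (fun y => G.J i (replace x i y) v) (x i)

section Stochastic

variable {Ξ : Type*} [MeasurableSpace Ξ] (P : Measure Ξ) (ξ : Ξ → EuclideanSpace ℝ (Fin d))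

/-- The expected-value cost `𝕁_i(x) = 𝔼[J_i(x, ξ)]`. -/
def cost (i : Fin N) (x : Profile n) : ℝ := ∫ θ, G.J i x (ξ θ) ∂P

/-- The pseudogradient `F(x) = col (𝔼[∇_{x_i} J_i(x, ξ)])`. -/
def pseudograd (x : Profile n) : Profile n :=
  WithLp.toLp 2 fun i => ∫ θ, G.gradJ i x (ξ θ) ∂P

/-- `x` solves `SVI(𝓧, F)`: `x ∈ 𝓧` and `⟪F x, y - x⟫ ≥ 0` for all `y ∈ 𝓧`. -/
def SolvesSVI (x : Profile n) : Prop :=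
  x ∈ G.feasible ∧ ∀ y ∈ G.feasible, 0 ≤ ⟪G.pseudograd P ξ x, y - x⟫

/-- `x` is a stochastic generalized Nash equilibrium. -/
def IsSGNE (x : Profile n) : Prop :=
  x ∈ G.feasible ∧
    ∀ i, ∀ y ∈ G.feasibleFor i x, G.cost P ξ i x ≤ G.cost P ξ i (replace x i y)

/-- `x` is a variational SGNE: an SGNE that solves the associated variational inequality. -/
def IsVSGNE (x : Profile n) : Prop := G.IsSGNE P ξ x ∧ G.SolvesSVI P ξ x

/-- The standing assumptions on the cost functions. -/
structure CostAssumption : Prop where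
  /-- each `J_i` is measurable on `ℝⁿ × ℝ^d` -/
  measurable_J : ∀ i, Measurable fun p : Profile n × EuclideanSpace ℝ (Fin d) => G.J i p.1 p.2
  /-- the expected costs are well defined -/
  integrable_J : ∀ i, ∀ x ∈ G.localSet, Integrable (fun θ => G.J i x (ξ θ)) P
  /-- the pseudogradient is well defined on `ℝⁿ` -/
  integrable_gradJ : ∀ i x, Integrable (fun θ => G.gradJ i x (ξ θ)) P
  /-- `𝕁_i(·, x_{-i})` is convex -/
  convex_cost : ∀ i, ∀ x ∈ G.localSet,
    ConvexOn ℝ (G.Ω i) fun y => G.cost P ξ i (replace x i y)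
  /-- `𝕁_i(·, x_{-i})` is continuously differentiable -/
  smooth_cost : ∀ i, ∀ x ∈ G.localSet,
    ContDiffOn ℝ 1 (fun y => G.cost P ξ i (replace x i y)) (G.Ω i)
  /-- `J_i(·, x_{-i}, v)` is convex -/
  convex_J : ∀ i, ∀ x ∈ G.localSet, ∀ v, ConvexOn ℝ (G.Ω i) fun y => G.J i (replace x i y) v
  /-- `J_i(·, x_{-i}, v)` is continuously differentiable -/
  smooth_J : ∀ i x v, ContDiff ℝ 1 fun y => G.J i (replace x i y) v
  /-- `J_i(·, x_{-i}, v)` is Lipschitz continuous with a constant `ℓ_i(x_{-i}, v)` that is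
  integrable with respect to the law of `ξ` -/
  lipschitz_J : ∀ i, ∀ x ∈ G.localSet, ∃ ℓ : EuclideanSpace ℝ (Fin d) → ℝ≥0,
    Integrable (fun θ => (ℓ (ξ θ) : ℝ)) P ∧
      ∀ v, LipschitzOnWith (ℓ v) (fun y => G.J i (replace x i y) v) (G.Ω i)

end Stochastic

/-- The assumptions on the constraint sets: each `Ω i` is nonempty, compact and convex, and Slater's
condition holds, i.e. some `x ∈ ∏ i, Ω i` satisfies `A x < b`. -/
structure ConstraintAssumption : Prop where
  nonempty : ∀ i, (G.Ω i).Nonempty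
  compact : ∀ i, IsCompact (G.Ω i)
  convex : ∀ i, Convex ℝ (G.Ω i)
  slater : ∃ x ∈ G.localSet, ∀ r, (∑ i, G.mulA i (x i)) r < (∑ i, G.b i) r

end Game

/-- The graph of a weight matrix `W`: distinct `i`, `j` are adjacent when `w_{ij} > 0`. -/
def commGraph {N : ℕ} (W : Matrix (Fin N) (Fin N) ℝ) : SimpleGraph (Fin N) :=
  SimpleGraph.fromRel fun i j => 0 < W i j

/-- `W` is the weighted adjacency matrix of an undirected connected graph. -/
structure GraphAssumption {N : ℕ} (W : Matrix (Fin N) (Fin N) ℝ) : Prop where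
  symm : W.IsSymm
  nonneg : ∀ i j, 0 ≤ W i j
  diag : ∀ i, W i i = 0
  connected : (commGraph W).Connected

/-- The `i`-th block `∑_j w_{ij} (u_i - u_j)` of `𝐋 u`, where `𝐋 = L ⊗ I_m` and `L` is the weighted
Laplacian of `W`. (The weight `w_{ij}` vanishes unless `j` is a neighbour of `i`.) -/
def lap {N m : ℕ} (W : Matrix (Fin N) (Fin N) ℝ) (u : Dual N m) (i : Fin N) :
    EuclideanSpace ℝ (Fin m) :=
  ∑ j, W i j • (u i - u j)

section Algorithm

variable {N : ℕ} {n : Fin N → ℕ} {m d : ℕ} (G : Game n m d) (W : Matrix (Fin N) (Fin N) ℝ)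

/-- The extended operator
`𝒜 (x, z, λ) = (F x + 𝐀ᵀ λ, 𝐋 λ, 𝐋 λ + 𝐛 - 𝐀 x - 𝐋 z)`, where `𝐀 = diag (A_1, …, A_N)` and
`𝐛 = col (b_1, …, b_N)`. -/
def extOp (F : Profile n → Profile n) (w : State n m) : State n m :=
  State.mk
    (WithLp.toLp 2 fun i => F w.primal i + G.mulAT i (w.dual i))
    (WithLp.toLp 2 fun i => lap W w.dual i)
    (WithLp.toLp 2 fun i => lap W w.dual i + G.b i - G.mulA i (w.primal i) - lap W w.aux i)

/-- The best (least) Lipschitz constant of a Lipschitz continuous map. -/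
def lipConst {E : Type*} [NormedAddCommGroup E] (T : E → E) : ℝ :=
  sInf {ℓ : ℝ | 0 ≤ ℓ ∧ ∀ u v, ‖T u - T v‖ ≤ ℓ * ‖u - v‖}

/-- One iteration of the distributed stochastic projected reflected gradient method, with step sizes
`α i`, `ν i`, `τ i`, from the last two iterates `wprev`, `w`; `Fhat` is the current approximation of
the pseudogradient. -/
def sprgStep (α ν τ : Fin N → ℝ) (Fhat : Profile n → Profile n) (wprev w : State n m) :
    State n m :=
  let xt : Profile n := (2 : ℝ) • w.primal - wprev.primal
  let zt : Dual N m := (2 : ℝ) • w.aux - wprev.aux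
  let lt : Dual N m := (2 : ℝ) • w.dual - wprev.dual
  State.mk
    (WithLp.toLp 2 fun i =>
      proj (G.Ω i) (w.primal i - α i • (Fhat xt i + G.mulAT i (lt i))))
    (WithLp.toLp 2 fun i => w.aux i - ν i • ∑ j, W i j • (lt i - lt j))
    (WithLp.toLp 2 fun i =>
      proj (orthant m)
        (w.dual i + τ i • (G.mulA i (xt i) - G.b i)
          + τ i • ∑ j, W i j • ((zt i - zt j) - (lt i - lt j))))

variable {Ξ : Type*} (B : ℕ → ℕ)
  (S : (k : ℕ) → Fin N → Fin (B k) → Ξ → EuclideanSpace ℝ (Fin d))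

/-- The sample average approximation of the pseudogradient at iteration `k`, with batch size `B k`;
`S k i s` is the `s`-th sample drawn by agent `i` at iteration `k`. -/
def sampleGrad (k : ℕ) (θ : Ξ) (x : Profile n) : Profile n :=
  WithLp.toLp 2 fun i => (1 / (B k : ℝ)) • ∑ s : Fin (B k), G.gradJ i x (S k i s θ)

/-- The pair `(ω^{k-1}, ω^k)` of consecutive iterates, started from `(ω^{-1}, ω^0) = (winit, w0)`. -/
def sprgPair (α ν τ : Fin N → ℝ) (winit w0 : Ξ → State n m) : ℕ → Ξ → State n m × State n m
  | 0, θ => (winit θ, w0 θ)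
  | k + 1, θ =>
    let p := sprgPair α ν τ winit w0 k θ
    (p.2, sprgStep G W α ν τ (sampleGrad G B S k θ) p.1 p.2)

/-- The primal iterate `x^k`. -/
def sprgX (α ν τ : Fin N → ℝ) (winit w0 : Ξ → State n m) (k : ℕ) (θ : Ξ) : Profile n :=
  (sprgPair G W B S α ν τ winit w0 k θ).2.primal

/-- The reflected point `x̃^k = 2 x^k - x^{k-1}`, at which the pseudogradient is sampled. -/
def sprgReflected (α ν τ : Fin N → ℝ) (winit w0 : Ξ → State n m) (k : ℕ) (θ : Ξ) : Profile n :=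
  let p := sprgPair G W B S α ν τ winit w0 k θ
  (2 : ℝ) • p.2.primal - p.1.primal

variable [MeasurableSpace Ξ] (P : Measure Ξ) (ξ : Ξ → EuclideanSpace ℝ (Fin d))

/-- The stochastic error `ε^k = F^SA(x̃^k, ξ^k) - F(x̃^k)`. -/
def sprgError (α ν τ : Fin N → ℝ) (winit w0 : Ξ → State n m) (k : ℕ) (θ : Ξ) : Profile n :=
  let y := sprgReflected G W B S α ν τ winit w0 k θ
  sampleGrad G B S k θ y - G.pseudograd P ξ y

/-- The information `𝓕_k` available at the beginning of iteration `k`: the σ-algebra generated by the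
initial data and by the samples drawn in the iterations before `k`. -/
abbrev info (winit w0 : Ξ → State n m) (k : ℕ) : MeasurableSpace Ξ :=
  MeasurableSpace.comap winit inferInstance ⊔ MeasurableSpace.comap w0 inferInstance ⊔
    ⨆ j : Fin k, ⨆ i : Fin N, ⨆ s : Fin (B j), MeasurableSpace.comap (S j i s) inferInstance

/-- The sampling model: the samples have the law of `ξ`, and they are independent across the draws
`(k, s)` (the agents may or may not share a draw). -/
structure SamplingAssumption : Prop where
  measurable : ∀ k i s, Measurable (S k i s)
  identDistrib : ∀ k i s, IdentDistrib (S k i s) ξ P P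
  indep : iIndepFun (fun (p : Σ k, Fin (B k)) (θ : Ξ) (i : Fin N) => S p.1 i p.2 θ) P

/-- The batch sizes grow at least like `c (k + k₀)^{a+1}` for some `c, k₀, a > 0`. -/
def BatchAssumption : Prop :=
  ∃ c k₀ a : ℝ, 0 < c ∧ 0 < k₀ ∧ 0 < a ∧ ∀ k : ℕ, c * ((k : ℝ) + k₀) ^ (a + 1) ≤ (B k : ℝ)

/-- The assumptions on an error process `ε` relative to the σ-algebras `𝓕`: it is
square integrable, conditionally unbiased, and `𝔼[‖ε^k‖² | 𝓕_k] ≤ C σ² / N_k` almost surely, where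
`N_k = B k`. -/
structure ErrorAssumption (ε : ℕ → Ξ → Profile n) (𝓕 : ℕ → MeasurableSpace Ξ) : Prop where
  memLp : ∀ k, MemLp (ε k) 2 P
  unbiased : ∀ k, P[ε k | 𝓕 k] =ᵐ[P] 0
  variance : ∃ C σ : ℝ, 0 < C ∧ 0 < σ ∧
    ∀ k, ∀ᵐ θ ∂P, (P[fun θ' => ‖ε k θ'‖ ^ 2 | 𝓕 k]) θ ≤ C * σ ^ 2 / (B k : ℝ)

end Algorithm

end

end SGNEP

open SGNEP

namespace SGNEP

/-! ### Projected reflected gradient method with errors -/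

section ReflectedGradient

variable {H : Type*} [NormedAddCommGroup H] [InnerProductSpace ℝ H]

/-! The shared constraint is decoupled by giving every agent its own multiplier and forcing
agreement through the auxiliary variable `z`. Under Slater's condition, the solutions of the game's
variational inequality are exactly the primal blocks of solutions of the variational inequality for
`extOp` on `stateSet` (`primal_of_extOp_solution`, `exists_extOp_solution`). The operator `extOp` is
Lipschitz, and it is monotone as a sum of the monotone pseudogradient, a positive semidefinite
Laplacian and a skew part. One iteration of the algorithm is a projected reflected gradient step for
it, preconditioned by the diagonal of step sizes; rescaling each block by the square root of its
step size turns this into a step of size one for an operator whose Lipschitz constant is below `√2 -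
1`.

For such a step, `reflected_gradient_descent` gives a Lyapunov inequality that decreases by a
multiple of `‖u (k+1) - u k‖ ^ 2`, up to squared errors and the term `⟪e (k+1), y (k+1) - z⟫`. The
squared errors are almost surely summable because the reciprocals of the batch sizes are. In the
last term the reflected point is known before the samples are drawn, so its partial sums form a
martingale bounded in L², which converges almost surely (`ae_tendsto_sum_inner`).

Hence, on almost every path, the iterates are bounded, consecutive iterates merge, and every cluster
point solves the extended inequality. Its primal block must be the unique solution of the game's
inequality, so the primal iterates converge, with no claim about the multipliers. The limit is an
equilibrium by the gradient inequality for convex costs. -/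

lemma reflected_scalar_bound {p q r : ℝ} :
    2 * (p + q) * r ≤ (1 + √2) * p ^ 2 + √2 * r ^ 2 + q ^ 2 := by
  have h2 : √2 * √2 = 2 := Real.mul_self_sqrt (by norm_num)
  have h1 : 0 ≤ √2 := Real.sqrt_nonneg 2
  -- The squares are completed using `(√2 - 1) * (1 + √2) = 1`, the identity behind the step-size
  -- threshold.
  have key : (1 + √2) * p ^ 2 + √2 * r ^ 2 + q ^ 2 - 2 * (p + q) * r
      = (1 + √2) * (p - (√2 - 1) * r) ^ 2 + (q - r) ^ 2 := by
    linear_combination (2 * p * r + r ^ 2 - √2 * r ^ 2) * h2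
  have : 0 ≤ (1 + √2) * (p - (√2 - 1) * r) ^ 2 + (q - r) ^ 2 := by positivity
  linarith

/-- The basic descent inequality of the projected reflected gradient method with errors. -/
lemma reflected_gradient_descent {C : Set H} {T : H → H} {L δ : ℝ} {z u₀ u₁ u₂ y₀ y₁ e₀ e₁ : H}
    (hmono : ∀ u v, 0 ≤ ⟪T u - T v, u - v⟫) (hL : 0 ≤ L)
    (hlip : ∀ u v, ‖T u - T v‖ ≤ L * ‖u - v‖) (hδ : 0 < δ) (hLδ : δ = 1 - L * (1 + √2))
    (hz : z ∈ C) (hu₀ : u₀ ∈ C) (hu₂ : u₂ ∈ C) (hy : y₁ = (2 : ℝ) • u₁ - u₀)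
    (h₀ : ∀ c ∈ C, ⟪u₀ - T y₀ - e₀ - u₁, c - u₁⟫ ≤ 0)
    (h₁ : ∀ c ∈ C, ⟪u₁ - T y₁ - e₁ - u₂, c - u₂⟫ ≤ 0) :
    ‖u₂ - z‖ ^ 2 + L * ‖u₂ - y₁‖ ^ 2 + 4 * ⟪T z, u₁ - z⟫ ≤
      ‖u₁ - z‖ ^ 2 + L * ‖u₁ - y₀‖ ^ 2 + 2 * ⟪T z, u₀ - z⟫ - δ * ‖u₁ - u₀‖ ^ 2
        - 2 * ⟪e₁, y₁ - z⟫ + 2 / δ * (‖e₁‖ ^ 2 + ‖e₀‖ ^ 2) := by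
  -- The reflected point need not lie in `C`, so it cannot serve as a test point. Instead the first
  -- step is tested at both `u₀` and `u₂`: since `(u₀ - u₁) + (u₂ - u₁) = u₂ - y₁`, the two tests
  -- add up to one in the direction `u₂ - y₁`.
  have hA := h₁ z hz
  have hB := h₀ u₀ hu₀
  have hC := h₀ u₂ hu₂
  have hM := hmono y₁ z
  set D := T y₁ - T y₀ with hD
  have hcs : ⟪D, y₁ - u₂⟫ ≤ L * (‖u₁ - u₀‖ + ‖u₁ - y₀‖) * ‖u₂ - y₁‖ := by
    refine (real_inner_le_norm _ _).trans ?_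
    rw [norm_sub_rev y₁ u₂]
    gcongr
    refine (hlip _ _).trans ?_
    gcongr
    have : y₁ - y₀ = (u₁ - u₀) + (u₁ - y₀) := by rw [hy, two_smul]; abel
    rw [this]; exact norm_add_le _ _
  -- The vector `y₁ - u₂` depends on the current error, so this term has no martingale structure and
  -- is absorbed by Young's inequality.
  have hE : 2 * ⟪e₁ - e₀, y₁ - u₂⟫ ≤ 2 / δ * (‖e₁‖ ^ 2 + ‖e₀‖ ^ 2) + δ * ‖u₂ - y₁‖ ^ 2 := by
    have h1 : ⟪e₁ - e₀, y₁ - u₂⟫ ≤ ‖e₁ - e₀‖ * ‖u₂ - y₁‖ := by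
      rw [norm_sub_rev u₂ y₁]; exact real_inner_le_norm _ _
    have h2 : ‖e₁ - e₀‖ ^ 2 ≤ 2 * (‖e₁‖ ^ 2 + ‖e₀‖ ^ 2) := by
      have := norm_sub_le e₁ e₀
      nlinarith [sq_nonneg (‖e₁‖ - ‖e₀‖), norm_nonneg (e₁ - e₀), norm_nonneg e₁, norm_nonneg e₀]
    have h3 : 2 * (‖e₁ - e₀‖ * ‖u₂ - y₁‖) ≤ 1 / δ * ‖e₁ - e₀‖ ^ 2 + δ * ‖u₂ - y₁‖ ^ 2 := by
      have : 1 / δ * ‖e₁ - e₀‖ ^ 2 + δ * ‖u₂ - y₁‖ ^ 2 - 2 * (‖e₁ - e₀‖ * ‖u₂ - y₁‖)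
          = 1 / δ * (‖e₁ - e₀‖ - δ * ‖u₂ - y₁‖) ^ 2 := by field_simp; ring
      have : 0 ≤ 1 / δ * (‖e₁ - e₀‖ - δ * ‖u₂ - y₁‖) ^ 2 := by positivity
      linarith
    have h4 : 1 / δ * ‖e₁ - e₀‖ ^ 2 ≤ 1 / δ * (2 * (‖e₁‖ ^ 2 + ‖e₀‖ ^ 2)) := by gcongr
    have h5 : 1 / δ * (2 * (‖e₁‖ ^ 2 + ‖e₀‖ ^ 2)) = 2 / δ * (‖e₁‖ ^ 2 + ‖e₀‖ ^ 2) := by ring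
    linarith
  have hS := mul_le_mul_of_nonneg_left
    (reflected_scalar_bound (p := ‖u₁ - u₀‖) (q := ‖u₁ - y₀‖) (r := ‖u₂ - y₁‖)) hL
  have key : ‖u₂ - z‖ ^ 2 + 4 * ⟪T z, u₁ - z⟫ = ‖u₁ - z‖ ^ 2 + 2 * ⟪T z, u₀ - z⟫
      - ‖u₁ - u₀‖ ^ 2 - ‖u₂ - y₁‖ ^ 2 - 2 * ⟪e₁, y₁ - z⟫ + 2 * ⟪D, y₁ - u₂⟫
      + 2 * ⟪e₁ - e₀, y₁ - u₂⟫ - 2 * ⟪T y₁ - T z, y₁ - z⟫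
      + 2 * ⟪u₁ - T y₁ - e₁ - u₂, z - u₂⟫ + 2 * ⟪u₀ - T y₀ - e₀ - u₁, u₀ - u₁⟫
      + 2 * ⟪u₀ - T y₀ - e₀ - u₁, u₂ - u₁⟫ := by
    rw [hD]
    generalize T y₁ = t₁
    generalize T y₀ = t₀
    generalize T z = tz
    simp only [← real_inner_self_eq_norm_sq, hy, inner_sub_left, inner_sub_right,
      inner_smul_left, inner_smul_right, RCLike.conj_to_real]
    simp only [real_inner_comm u₁ u₂, real_inner_comm u₀ u₂, real_inner_comm u₀ u₁,
      real_inner_comm z u₂, real_inner_comm z u₁]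
    ring
  -- The choice of `δ` balances two coefficients: `-1 + L * (1 + √2) = -δ` for `‖u₁ - u₀‖ ^ 2`, and
  -- `-1 + L * √2 + δ = -L` for `‖u₂ - y₁‖ ^ 2`.
  rw [hLδ] at *
  nlinarith

/-- Boundedness and asymptotic regularity of the projected reflected gradient method with errors. -/
lemma reflected_gradient_bounded {C : Set H} {T : H → H} {L : ℝ} {z : H} {u y e : ℕ → H}
    (hmono : ∀ u v, 0 ≤ ⟪T u - T v, u - v⟫) (hL : 0 ≤ L)
    (hlip : ∀ u v, ‖T u - T v‖ ≤ L * ‖u - v‖) (hL2 : L < √2 - 1)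
    (hz : z ∈ C) (hTz : ∀ c ∈ C, 0 ≤ ⟪T z, c - z⟫) (hu : ∀ k, u k ∈ C)
    (hy : ∀ k, y (k + 1) = (2 : ℝ) • u (k + 1) - u k)
    (hVI : ∀ k, ∀ c ∈ C, ⟪u k - T (y k) - e k - u (k + 1), c - u (k + 1)⟫ ≤ 0)
    {R : ℝ} (hR : ∀ n, -R ≤ ∑ k ∈ Finset.range n, ⟪e (k + 1), y (k + 1) - z⟫)
    (he : Summable fun k => ‖e k‖ ^ 2) :
    (∃ K, ∀ k, ‖u k‖ ≤ K) ∧ Tendsto (fun k => u (k + 1) - u k) atTop (𝓝 0) := by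
  have h2 : √2 * √2 = 2 := Real.mul_self_sqrt (by norm_num)
  have h1 : 0 ≤ √2 := Real.sqrt_nonneg 2
  obtain ⟨δ, hδ⟩ : ∃ δ, δ = 1 - L * (1 + √2) := ⟨_, rfl⟩
  -- Positivity of `δ` is equivalent to `L < √2 - 1`.
  have hδ0 : 0 < δ := by rw [hδ]; nlinarith
  set V : ℕ → ℝ := fun k => ‖u (k + 1) - z‖ ^ 2 + L * ‖u (k + 1) - y k‖ ^ 2
    + 2 * ⟪T z, u k - z⟫ with hV
  -- Descent leaves `4 * ⟪T z, u (k+1) - z⟫` on the left while `V (k+1)` contains only half of it;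
  -- the nonnegative surplus is dropped.
  have ha : ∀ k, 0 ≤ ⟪T z, u k - z⟫ := fun k => hTz _ (hu k)
  have hstep : ∀ k, V (k + 1) ≤ V k - δ * ‖u (k + 1) - u k‖ ^ 2
      - 2 * ⟪e (k + 1), y (k + 1) - z⟫ + 2 / δ * (‖e (k + 1)‖ ^ 2 + ‖e k‖ ^ 2) := fun k => by
    have := reflected_gradient_descent hmono hL hlip hδ0 hδ hz (hu k) (hu (k + 2)) (hy k)
      (hVI k) (hVI (k + 1))
    have := ha (k + 1)
    simp only [hV]
    linarith
  have hsum : ∀ n, V n + δ * ∑ k ∈ Finset.range n, ‖u (k + 1) - u k‖ ^ 2 ≤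
      V 0 - 2 * ∑ k ∈ Finset.range n, ⟪e (k + 1), y (k + 1) - z⟫
        + 2 / δ * (∑ k ∈ Finset.range n, ‖e (k + 1)‖ ^ 2 + ∑ k ∈ Finset.range n, ‖e k‖ ^ 2) := by
    intro n
    induction n with
    | zero => simp
    | succ n ih =>
      simp only [Finset.sum_range_succ]
      have := hstep n
      linarith
  have hsE : ∀ n, ∑ k ∈ Finset.range n, ‖e k‖ ^ 2 ≤ ∑' k, ‖e k‖ ^ 2 := fun n =>
    he.sum_le_tsum _ fun _ _ => by positivity
  have hsE' : ∀ n, ∑ k ∈ Finset.range n, ‖e (k + 1)‖ ^ 2 ≤ ∑' k, ‖e (k + 1)‖ ^ 2 := fun n =>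
    ((summable_nat_add_iff 1).2 he).sum_le_tsum _ fun _ _ => by positivity
  obtain ⟨K, hK⟩ : ∃ K, K = V 0 + 2 * R
      + 2 / δ * ((∑' k, ‖e (k + 1)‖ ^ 2) + ∑' k, ‖e k‖ ^ 2) := ⟨_, rfl⟩
  have hbound : ∀ n, V n + δ * ∑ k ∈ Finset.range n, ‖u (k + 1) - u k‖ ^ 2 ≤ K := fun n => by
    have hA := hsum n
    have hB := hR n
    have hC : 2 / δ * (∑ k ∈ Finset.range n, ‖e (k + 1)‖ ^ 2 + ∑ k ∈ Finset.range n, ‖e k‖ ^ 2)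
        ≤ 2 / δ * ((∑' k, ‖e (k + 1)‖ ^ 2) + ∑' k, ‖e k‖ ^ 2) := by
      gcongr
      exacts [hsE' n, hsE n]
    rw [hK]
    linarith
  have hVlow : ∀ n, ‖u (n + 1) - z‖ ^ 2 ≤ V n := fun n => by
    have := ha n
    have : 0 ≤ L * ‖u (n + 1) - y n‖ ^ 2 := by positivity
    simp only [hV]; linarith
  have hs0 : ∀ n, 0 ≤ ∑ k ∈ Finset.range n, ‖u (k + 1) - u k‖ ^ 2 := fun n =>
    Finset.sum_nonneg fun _ _ => by positivity
  constructor
  · refine ⟨max ‖u 0‖ (√K + ‖z‖), fun k => ?_⟩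
    rcases k with _ | k
    · exact le_max_left _ _
    · refine le_max_of_le_right ?_
      have h3 : ‖u (k + 1) - z‖ ≤ √K := by
        apply Real.le_sqrt_of_sq_le
        have := hbound k
        have := hVlow k
        have := mul_nonneg hδ0.le (hs0 k)
        linarith
      have : u (k + 1) = (u (k + 1) - z) + z := by abel
      rw [this]
      exact (norm_add_le _ _).trans (by gcongr)
  · have hsm : Summable fun k => ‖u (k + 1) - u k‖ ^ 2 := by
      refine summable_of_sum_range_le (c := K / δ) (fun _ => by positivity) fun n => ?_
      rw [le_div_iff₀ hδ0]
      have := hbound n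
      have := hVlow n
      have := sq_nonneg ‖u (n + 1) - z‖
      linarith
    have h3 := hsm.tendsto_atTop_zero.sqrt
    simp only [Real.sqrt_zero, Real.sqrt_sq (norm_nonneg _)] at h3
    exact tendsto_zero_iff_norm_tendsto_zero.2 h3

/-- Cluster points of the projected reflected gradient method with vanishing errors solve the
variational inequality. -/
lemma reflected_gradient_cluster {C : Set H} (hC : IsClosed C) {T : H → H} (hT : Continuous T)
    {u y e : ℕ → H} (hu : ∀ k, u k ∈ C) (hy : ∀ k, y (k + 1) = (2 : ℝ) • u (k + 1) - u k)
    (hVI : ∀ k, ∀ c ∈ C, ⟪u k - T (y k) - e k - u (k + 1), c - u (k + 1)⟫ ≤ 0)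
    (hreg : Tendsto (fun k => u (k + 1) - u k) atTop (𝓝 0)) (he : Tendsto e atTop (𝓝 0))
    {φ : ℕ → ℕ} (hφ : Tendsto φ atTop atTop) {v : H}
    (hv : Tendsto (fun k => u (φ k)) atTop (𝓝 v)) :
    v ∈ C ∧ ∀ c ∈ C, 0 ≤ ⟪T v, c - v⟫ := by
  refine ⟨hC.mem_of_tendsto hv (Eventually.of_forall fun k => hu _), fun c hc => ?_⟩
  have h1 : Tendsto (fun k => u (φ k + 1)) atTop (𝓝 v) := by
    have := hv.add (hreg.comp hφ)
    simpa using this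
  have h2 : Tendsto (fun k => u (φ k + 2)) atTop (𝓝 v) := by
    have := h1.add (hreg.comp ((tendsto_add_atTop_nat 1).comp hφ))
    simpa [Function.comp_def] using this
  have h3 : Tendsto (fun k => y (φ k + 1)) atTop (𝓝 v) := by
    simp only [hy]
    have := (h1.const_smul (2 : ℝ)).sub hv
    rwa [two_smul, add_sub_cancel_right] at this
  have h4 : Tendsto (fun k => e (φ k + 1)) atTop (𝓝 0) :=
    he.comp ((tendsto_add_atTop_nat 1).comp hφ)
  -- The inequality is read at index `φ k + 1`, because `hy` says nothing about `y 0`.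
  have h5 := (((h1.sub ((hT.tendsto v).comp h3)).sub h4).sub h2).inner (𝕜 := ℝ)
    (tendsto_const_nhds (x := c) |>.sub h2)
  have h6 := le_of_tendsto h5 (Eventually.of_forall fun k => hVI (φ k + 1) c hc)
  simp only [sub_zero, sub_right_comm v (T v) v, sub_self, zero_sub, inner_neg_left] at h6
  linarith

end ReflectedGradient

/-- Lagrange multipliers for a convex program under Slater's condition, normalised so that the
optimal value is nonnegative. -/
lemma exists_lagrange_multiplier {E ι : Type*} [AddCommGroup E] [Module ℝ E] [Fintype ι]
    {Ω : Set E} {f : E → ℝ} {g : E → ι → ℝ} (hf : ConvexOn ℝ Ω f)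
    (hg : ∀ r, ConvexOn ℝ Ω fun x => g x r) (hs : ∃ y ∈ Ω, ∀ r, g y r < 0)
    (hopt : ∀ y ∈ Ω, (∀ r, g y r ≤ 0) → 0 ≤ f y) :
    ∃ μ : ι → ℝ, (∀ r, 0 ≤ μ r) ∧ ∀ y ∈ Ω, 0 ≤ f y + ∑ r, μ r * g y r := by
  classical
  obtain ⟨s, hsΩ, hs⟩ := hs
  -- The strict inequalities make `K` open, and `hopt` keeps the origin out of it, so Hahn–Banach
  -- separates the two.
  let K : Set ((ι → ℝ) × ℝ) := {p | ∃ y ∈ Ω, (∀ r, g y r < p.1 r) ∧ f y < p.2}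
  have hKo : IsOpen K := by
    have : K = ⋃ y ∈ Ω, (⋂ r, {p : (ι → ℝ) × ℝ | g y r < p.1 r}) ∩ {p | f y < p.2} := by
      ext p; simp [K, and_left_comm]
    rw [this]
    refine isOpen_biUnion fun y _ => (isOpen_iInter_of_finite fun r => ?_).inter ?_
    · exact isOpen_lt continuous_const ((continuous_apply r).comp continuous_fst)
    · exact isOpen_lt continuous_const continuous_snd
  have hKc : Convex ℝ K := by
    rintro p ⟨y, hy, hyg, hyf⟩ q ⟨w, hw, hwg, hwf⟩ a b ha hb hab
    have aux : ∀ {s t s' t' : ℝ}, s < s' → t < t' → a * s + b * t < a * s' + b * t' := by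
      intro s t s' t' h1 h2
      rcases ha.eq_or_lt with rfl | ha
      · simp at hab; subst hab; simpa using h2
      · have := mul_lt_mul_of_pos_left h1 ha
        have := mul_le_mul_of_nonneg_left h2.le hb
        linarith
    refine ⟨a • y + b • w, hf.1 hy hw ha hb hab, fun r => ?_, ?_⟩
    · exact ((hg r).2 hy hw ha hb hab).trans_lt (aux (hyg r) (hwg r))
    · exact (hf.2 hy hw ha hb hab).trans_lt (aux hyf hwf)
  have h0 : (0 : (ι → ℝ) × ℝ) ∉ K := by
    rintro ⟨y, hy, hyg, hyf⟩
    exact absurd (hopt y hy fun r => (hyg r).le) (not_le.2 hyf)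
  obtain ⟨φ, hφ⟩ := geometric_hahn_banach_point_open hKc hKo h0
  rw [map_zero] at hφ
  let l : ι → ℝ := fun r => φ (Pi.single r 1, 0)
  let β : ℝ := φ (0, 1)
  have hrep : ∀ (w : ι → ℝ) (t : ℝ), φ (w, t) = ∑ r, l r * w r + β * t := by
    intro w t
    have h1 : (w, t) = ∑ r, w r • ((Pi.single r 1, 0) : (ι → ℝ) × ℝ) + t • (0, 1) := by
      refine Prod.ext ?_ ?_
      · ext r
        simp [Prod.fst_sum, Finset.sum_apply, Pi.single_apply]
      · simp [Prod.snd_sum]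
    rw [h1, map_add, map_sum, map_smul]
    simp only [map_smul, smul_eq_mul]
    simp only [l, β, mul_comm]
  obtain ⟨t₀, ht₀, ht₀'⟩ : ∃ t₀ : ℝ, f s < t₀ ∧ 0 < t₀ :=
    ⟨max (f s) 0 + 1, by linarith [le_max_left (f s) 0], by linarith [le_max_right (f s) 0]⟩
  -- The Slater point puts `(0, t₀)` in `K`, which rules out a vertical separating hyperplane.
  have hβ : 0 < β := by
    have := hφ (0, t₀) ⟨s, hsΩ, hs, ht₀⟩
    rw [hrep] at this
    simp only [Pi.zero_apply, mul_zero, Finset.sum_const_zero, zero_add] at this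
    exact pos_of_mul_pos_left this ht₀'.le
  have hl : ∀ r, 0 ≤ l r := by
    intro r
    by_contra! hr
    -- If `l r` were negative, this increment in coordinate `r` would reach a point of `K` at which
    -- `φ` vanishes.
    have hM : 0 ≤ β * t₀ / -l r := by
      have : 0 < -l r := by linarith
      positivity
    have := hφ (Pi.single r (β * t₀ / -l r), t₀) ⟨s, hsΩ, fun r' => (hs r').trans_le ?_, ht₀⟩
    · rw [hrep] at this
      simp only [Pi.single_apply, mul_ite, mul_zero, Finset.sum_ite_eq', Finset.mem_univ,
        if_true] at this
      have h2 : l r * (β * t₀ / -l r) = -(β * t₀) := by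
        have := hr.ne
        field_simp
      linarith
    · by_cases h : r' = r
      · subst h; simpa using hM
      · simp [h]
  -- The point `(g y, f y)` itself is not in `K`; it is approached through shifts by `η > 0`.
  have hmain : ∀ y ∈ Ω, 0 ≤ ∑ r, l r * g y r + β * f y := by
    intro y hy
    have hlim : Tendsto (fun η : ℝ => ∑ r, l r * (g y r + η) + β * (f y + η)) (𝓝[>] 0)
        (𝓝 (∑ r, l r * (g y r + 0) + β * (f y + 0))) := by
      apply Tendsto.mono_left _ nhdsWithin_le_nhds
      apply Continuous.tendsto
      fun_prop
    simp only [add_zero] at hlim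
    refine ge_of_tendsto hlim ?_
    filter_upwards [self_mem_nhdsWithin] with η hη
    have hη : 0 < η := hη
    have := hφ (fun r => g y r + η, f y + η) ⟨y, hy, fun r => by simpa using hη, by simpa using hη⟩
    rw [hrep] at this
    exact this.le
  refine ⟨fun r => l r / β, fun r => div_nonneg (hl r) hβ.le, fun y hy => ?_⟩
  have h1 : f y + ∑ r, l r / β * g y r = (∑ r, l r * g y r + β * f y) / β := by
    rw [add_div, Finset.sum_div, mul_div_cancel_left₀ _ hβ.ne', add_comm]
    congr 1
    exact Finset.sum_congr rfl fun r _ => by ring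
  rw [h1]
  exact div_nonneg (hmain y hy) hβ.le

/-! ### The weighted Laplacian of a connected graph -/

section Laplacian

variable {N m : ℕ} {W : Matrix (Fin N) (Fin N) ℝ}

/-- The Dirichlet form of the weighted Laplacian. -/
lemma sum_inner_lap (hW : GraphAssumption W) (u v : Dual N m) :
    ∑ i, ⟪lap W u i, v i⟫ = (1 / 2) * ∑ i, ∑ j, W i j * ⟪u i - u j, v i - v j⟫ := by
  have h1 : ∑ i, ⟪lap W u i, v i⟫ = ∑ i, ∑ j, W i j * ⟪u i - u j, v i⟫ := by
    simp only [lap, sum_inner, real_inner_smul_left]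
  -- Exchanging the two indices, by symmetry of `W`, gives a second expression; averaging it with
  -- the first yields the Dirichlet form.
  have h2 : ∑ i, ⟪lap W u i, v i⟫ = ∑ i, ∑ j, W i j * ⟪u j - u i, v j⟫ := by
    rw [h1, Finset.sum_comm]
    exact Finset.sum_congr rfl fun i _ => Finset.sum_congr rfl fun j _ => by rw [hW.symm.apply i j]
  have h3 : ∑ i, ∑ j, W i j * ⟪u i - u j, v i - v j⟫
      = ∑ i, ∑ j, W i j * ⟪u i - u j, v i⟫ + ∑ i, ∑ j, W i j * ⟪u j - u i, v j⟫ := by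
    simp only [← Finset.sum_add_distrib]
    refine Finset.sum_congr rfl fun i _ => Finset.sum_congr rfl fun j _ => ?_
    rw [inner_sub_right, ← neg_sub (u i) (u j), inner_neg_left]
    ring
  rw [h3, ← h1, ← h2]
  ring

lemma sum_inner_lap_comm (hW : GraphAssumption W) (u v : Dual N m) :
    ∑ i, ⟪lap W u i, v i⟫ = ∑ i, ⟪u i, lap W v i⟫ := by
  simp_rw [real_inner_comm (lap W v _)]
  rw [sum_inner_lap hW, sum_inner_lap hW]
  simp_rw [real_inner_comm (v _ - v _)]

lemma sum_inner_lap_self_nonneg (hW : GraphAssumption W) (u : Dual N m) :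
    0 ≤ ∑ i, ⟪lap W u i, u i⟫ := by
  rw [sum_inner_lap hW]
  have := hW.nonneg
  refine mul_nonneg (by norm_num) (Finset.sum_nonneg fun i _ => Finset.sum_nonneg fun j _ =>
    mul_nonneg (this i j) real_inner_self_nonneg)

lemma sum_lap (hW : GraphAssumption W) (u : Dual N m) : ∑ i, lap W u i = 0 := by
  have h : ∑ i, lap W u i = -∑ i, lap W u i := by
    conv_lhs => simp only [lap]
    rw [Finset.sum_comm, ← Finset.sum_neg_distrib]
    refine Finset.sum_congr rfl fun i _ => ?_
    rw [lap, ← Finset.sum_neg_distrib]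
    refine Finset.sum_congr rfl fun j _ => ?_
    rw [hW.symm.apply i j, ← smul_neg, neg_sub]
  have h2 : (2 : ℝ) • ∑ i, lap W u i = 0 := by
    rw [two_smul]; nth_rewrite 1 [h]; exact neg_add_cancel _
  exact (smul_eq_zero.1 h2).resolve_left two_ne_zero

lemma lap_of_consensus {u : Dual N m} (hu : ∀ i j, u i = u j) (i : Fin N) : lap W u i = 0 := by
  simp only [lap]
  exact Finset.sum_eq_zero fun j _ => by rw [hu i j, sub_self, smul_zero]

/-- The Dirichlet form of `u` vanishes, so `u` agrees across every edge of positive weight and hence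
along walks. -/
lemma consensus_of_lap_eq_zero (hW : GraphAssumption W) {u : Dual N m} (hu : ∀ i, lap W u i = 0)
    (i j : Fin N) : u i = u j := by
  have h0 : ∑ i, ∑ j, W i j * ⟪u i - u j, u i - u j⟫ = 0 := by
    have := sum_inner_lap hW u u
    simp only [hu, inner_zero_left, Finset.sum_const_zero] at this
    linarith
  have hnn : ∀ i j, 0 ≤ W i j * ⟪u i - u j, u i - u j⟫ := fun i j =>
    mul_nonneg (hW.nonneg i j) real_inner_self_nonneg
  have h1 : ∀ i j, 0 < W i j → u i = u j := by
    intro i j hij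
    have h2 := (Finset.sum_eq_zero_iff_of_nonneg fun i _ =>
      Finset.sum_nonneg fun j _ => hnn i j).1 h0 i (Finset.mem_univ i)
    have h3 := (Finset.sum_eq_zero_iff_of_nonneg fun j _ => hnn i j).1 h2 j (Finset.mem_univ j)
    rcases mul_eq_zero.1 h3 with h | h
    · exact absurd h hij.ne'
    · exact sub_eq_zero.1 (inner_self_eq_zero.1 h)
  obtain ⟨p⟩ := hW.connected.preconnected i j
  induction p with
  | nil => rfl
  | cons h _ ih =>
    refine Eq.trans ?_ ih
    rw [commGraph, SimpleGraph.fromRel_adj] at h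
    rcases h.2 with h | h
    · exact h1 _ _ h
    · exact (h1 _ _ h).symm

lemma lap_add (u v : Dual N m) (i : Fin N) : lap W (u + v) i = lap W u i + lap W v i := by
  simp only [lap, ← Finset.sum_add_distrib, ← smul_add, PiLp.add_apply]
  exact Finset.sum_congr rfl fun j _ => by congr 1; abel

lemma lap_smul (c : ℝ) (u : Dual N m) (i : Fin N) : lap W (c • u) i = c • lap W u i := by
  simp only [lap, Finset.smul_sum, PiLp.smul_apply, ← smul_sub]
  exact Finset.sum_congr rfl fun j _ => smul_comm _ _ _

lemma lap_sub (u v : Dual N m) (i : Fin N) : lap W (u - v) i = lap W u i - lap W v i := by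
  have := lap_add (W := W) (u - v) v i
  rw [sub_add_cancel] at this
  rw [this, add_sub_cancel_right]

/-- The weighted Laplacian as a linear map. -/
noncomputable def lapLin (W : Matrix (Fin N) (Fin N) ℝ) : Dual N m →ₗ[ℝ] Dual N m where
  toFun u := WithLp.toLp 2 fun i => lap W u i
  map_add' u v := PiLp.ext fun i => lap_add u v i
  map_smul' c u := PiLp.ext fun i => lap_smul c u i

lemma lapLin_apply (u : Dual N m) (i : Fin N) : lapLin W u i = lap W u i := rfl

/-- The range of the Laplacian of a connected graph consists of the vectors with zero sum. -/
lemma exists_lap_eq (hW : GraphAssumption W) (t : Dual N m) (ht : ∑ i, t i = 0) :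
    ∃ z : Dual N m, ∀ i, lap W z i = t i := by
  have hmem : t ∈ LinearMap.range (lapLin W : Dual N m →ₗ[ℝ] Dual N m) := by
    -- A vector `v` orthogonal to the range is in the kernel: by symmetry, `⟪L (L v), v⟫ = ‖L v‖ ^
    -- 2`. It is then a consensus vector, which is orthogonal to any `t` with zero sum.
    rw [← Submodule.orthogonal_orthogonal (LinearMap.range (lapLin W))]
    rw [Submodule.mem_orthogonal]
    intro v hv
    have h1 : lapLin W v = 0 := by
      rw [← inner_self_eq_zero (𝕜 := ℝ)]
      have := (Submodule.mem_orthogonal _ _).1 hv (lapLin W (lapLin W v)) ⟨_, rfl⟩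
      rw [PiLp.inner_apply] at this ⊢
      rw [← this]
      exact (sum_inner_lap_comm hW _ _).symm
    have h2 : ∀ i j, v i = v j := consensus_of_lap_eq_zero hW fun i => by
      rw [← lapLin_apply, h1]; rfl
    obtain ⟨i₀⟩ := hW.connected.nonempty
    rw [PiLp.inner_apply]
    simp_rw [fun i => h2 i i₀]
    rw [← inner_sum, ht, inner_zero_right]
  obtain ⟨z, hz⟩ := hmem
  exact ⟨z, fun i => by rw [← hz, lapLin_apply]⟩

end Laplacian

/-! ### The Euclidean space of triples -/

namespace State

variable {N : ℕ} {n : Fin N → ℕ} {m : ℕ}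

@[simp] lemma primal_mk (x : Profile n) (z l : Dual N m) : (mk x z l).primal = x := rfl
@[simp] lemma aux_mk (x : Profile n) (z l : Dual N m) : (mk x z l).aux = z := rfl
@[simp] lemma dual_mk (x : Profile n) (z l : Dual N m) : (mk x z l).dual = l := rfl
@[simp] lemma primal_add (v w : State n m) : (v + w).primal = v.primal + w.primal := rfl
@[simp] lemma aux_add (v w : State n m) : (v + w).aux = v.aux + w.aux := rfl
@[simp] lemma dual_add (v w : State n m) : (v + w).dual = v.dual + w.dual := rfl
@[simp] lemma primal_sub (v w : State n m) : (v - w).primal = v.primal - w.primal := rfl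
@[simp] lemma aux_sub (v w : State n m) : (v - w).aux = v.aux - w.aux := rfl
@[simp] lemma dual_sub (v w : State n m) : (v - w).dual = v.dual - w.dual := rfl
@[simp] lemma primal_smul (c : ℝ) (w : State n m) : (c • w).primal = c • w.primal := rfl
@[simp] lemma aux_smul (c : ℝ) (w : State n m) : (c • w).aux = c • w.aux := rfl
@[simp] lemma dual_smul (c : ℝ) (w : State n m) : (c • w).dual = c • w.dual := rfl

lemma ext_blocks {v w : State n m} (hp : ∀ i, v.primal i = w.primal i)
    (ha : ∀ i, v.aux i = w.aux i) (hd : ∀ i, v.dual i = w.dual i) : v = w := by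
  have h1 : v.primal = w.primal := PiLp.ext hp
  have h2 : v.aux = w.aux := PiLp.ext ha
  have h3 : v.dual = w.dual := PiLp.ext hd
  calc v = mk v.primal v.aux v.dual := rfl
    _ = mk w.primal w.aux w.dual := by rw [h1, h2, h3]
    _ = w := rfl

lemma inner_eq (v w : State n m) :
    ⟪v, w⟫ = ⟪v.primal, w.primal⟫ + (⟪v.aux, w.aux⟫ + ⟪v.dual, w.dual⟫) := rfl

lemma inner_eq_sum (v w : State n m) :
    ⟪v, w⟫ = ∑ i, ⟪v.primal i, w.primal i⟫
      + (∑ i, ⟪v.aux i, w.aux i⟫ + ∑ i, ⟪v.dual i, w.dual i⟫) := by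
  rw [inner_eq, PiLp.inner_apply, PiLp.inner_apply, PiLp.inner_apply]

lemma norm_sq_eq (w : State n m) :
    ‖w‖ ^ 2 = ‖w.primal‖ ^ 2 + (‖w.aux‖ ^ 2 + ‖w.dual‖ ^ 2) := by
  simp only [← real_inner_self_eq_norm_sq, inner_eq]

lemma norm_primal_le (w : State n m) : ‖w.primal‖ ≤ ‖w‖ := by
  apply le_of_sq_le_sq _ (norm_nonneg _)
  rw [norm_sq_eq w]
  have := sq_nonneg ‖w.aux‖
  have := sq_nonneg ‖w.dual‖
  linarith

lemma norm_mk_zero (x : Profile n) : ‖(mk x 0 0 : State n m)‖ = ‖x‖ := by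
  have := norm_sq_eq (mk x 0 0 : State n m)
  simp only [primal_mk, aux_mk, dual_mk, norm_zero] at this
  exact (sq_eq_sq₀ (norm_nonneg _) (norm_nonneg _)).1 (by linarith)

lemma continuous_primal : Continuous (primal : State n m → Profile n) :=
  continuous_fst.comp (WithLp.prod_continuous_ofLp _ _ _)

lemma continuous_aux : Continuous (aux : State n m → Dual N m) :=
  (continuous_fst.comp (WithLp.prod_continuous_ofLp _ _ _)).comp
    (continuous_snd.comp (WithLp.prod_continuous_ofLp _ _ _))

lemma continuous_dual : Continuous (dual : State n m → Dual N m) :=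
  (continuous_snd.comp (WithLp.prod_continuous_ofLp _ _ _)).comp
    (continuous_snd.comp (WithLp.prod_continuous_ofLp _ _ _))

lemma continuous_mk : Continuous fun p : Profile n × Dual N m × Dual N m =>
    (mk p.1 p.2.1 p.2.2 : State n m) :=
  (WithLp.prod_continuous_toLp _ _ _).comp (continuous_fst.prodMk
    ((WithLp.prod_continuous_toLp _ _ _).comp continuous_snd))

end State

namespace Game

variable {N : ℕ} {n : Fin N → ℕ} {m d : ℕ} (G : Game n m d)

lemma mulA_sub (i : Fin N) (x y : EuclideanSpace ℝ (Fin (n i))) :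
    G.mulA i (x - y) = G.mulA i x - G.mulA i y := map_sub _ _ _

lemma mulAT_sub (i : Fin N) (x y : EuclideanSpace ℝ (Fin m)) :
    G.mulAT i (x - y) = G.mulAT i x - G.mulAT i y := map_sub _ _ _

lemma inner_mulAT (i : Fin N) (l : EuclideanSpace ℝ (Fin m)) (x : EuclideanSpace ℝ (Fin (n i))) :
    ⟪G.mulAT i l, x⟫ = ⟪l, G.mulA i x⟫ := by
  have h := Matrix.toEuclideanLin_conjTranspose_eq_adjoint (𝕜 := ℝ) (G.A i)
  rw [Matrix.conjTranspose_eq_transpose_of_trivial] at h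
  rw [mulAT, h, LinearMap.adjoint_inner_left]
  rfl

/-- The set `∏ i, Ω i × ℝ^{Nm} × ℝ^{Nm}_{≥0}` to which the iterates are confined. -/
def stateSet : Set (State n m) := {w | (∀ i, w.primal i ∈ G.Ω i) ∧ ∀ i, w.dual i ∈ orthant m}

end Game

/-! ### Monotonicity and Lipschitz continuity of the extended operator -/

section ExtOp

variable {N : ℕ} {n : Fin N → ℕ} {m d : ℕ} (G : Game n m d) {W : Matrix (Fin N) (Fin N) ℝ}
  {F : Profile n → Profile n}

/-- The pairs `𝐀ᵀ λ`, `-𝐀 x` and `𝐋 λ`, `-𝐋 z` are skew and cancel. What remains is the monotone `F`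
and the Dirichlet form of the difference of the dual blocks. -/
lemma extOp_monotone (hW : GraphAssumption W) (hF : ∀ x y, 0 ≤ ⟪F x - F y, x - y⟫)
    (v w : State n m) : 0 ≤ ⟪extOp G W F v - extOp G W F w, v - w⟫ := by
  have key : ⟪extOp G W F v - extOp G W F w, v - w⟫
      = ⟪F v.primal - F w.primal, v.primal - w.primal⟫
        + ∑ i, ⟪lap W (v.dual - w.dual) i, (v.dual - w.dual) i⟫
        + (∑ i, ⟪lap W (v.dual - w.dual) i, (v.aux - w.aux) i⟫
          - ∑ i, ⟪(v.dual - w.dual) i, lap W (v.aux - w.aux) i⟫) := by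
    rw [State.inner_eq_sum, PiLp.inner_apply, ← Finset.sum_sub_distrib]
    simp only [← Finset.sum_add_distrib]
    refine Finset.sum_congr rfl fun i _ => ?_
    simp only [extOp, State.primal_sub, State.aux_sub, State.dual_sub, State.primal_mk,
      State.aux_mk, State.dual_mk, PiLp.sub_apply]
    have h1 : F v.primal i + G.mulAT i (v.dual i) - (F w.primal i + G.mulAT i (w.dual i))
        = (F v.primal i - F w.primal i) + G.mulAT i (v.dual i - w.dual i) := by
      rw [G.mulAT_sub]; abel
    have h2 : lap W v.dual i + G.b i - G.mulA i (v.primal i) - lap W v.aux i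
        - (lap W w.dual i + G.b i - G.mulA i (w.primal i) - lap W w.aux i)
        = lap W (v.dual - w.dual) i - G.mulA i (v.primal i - w.primal i)
          - lap W (v.aux - w.aux) i := by
      rw [G.mulA_sub, lap_sub, lap_sub]; abel
    rw [h1, h2, ← lap_sub]
    simp only [inner_add_left, inner_sub_left, G.inner_mulAT]
    rw [
      real_inner_comm (v.dual i - w.dual i) (G.mulA i _),
      real_inner_comm (v.dual i - w.dual i) (lap W (v.aux - w.aux) i)]
    simp only [inner_sub_left]
    ring
  rw [key, sum_inner_lap_comm hW (v.dual - w.dual) (v.aux - w.aux), sub_self, add_zero]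
  exact add_nonneg (hF _ _) (sum_inner_lap_self_nonneg hW _)

/-- The linear part of the extended operator. -/
noncomputable def extLin (W : Matrix (Fin N) (Fin N) ℝ) : State n m →ₗ[ℝ] State n m where
  toFun w := State.mk (WithLp.toLp 2 fun i => G.mulAT i (w.dual i))
    (WithLp.toLp 2 fun i => lap W w.dual i)
    (WithLp.toLp 2 fun i => lap W w.dual i - G.mulA i (w.primal i) - lap W w.aux i)
  map_add' v w := by
    refine State.ext_blocks (fun i => ?_) (fun i => ?_) fun i => ?_
    · exact map_add _ _ _
    · exact lap_add _ _ _
    · simp only [State.dual_mk, State.dual_add, State.aux_add, State.primal_add, PiLp.add_apply,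
        lap_add, Game.mulA, map_add]
      abel
  map_smul' c w := by
    refine State.ext_blocks (fun i => ?_) (fun i => ?_) fun i => ?_
    · exact map_smul (Matrix.toEuclideanLin (G.A i).transpose) c (w.dual i)
    · exact lap_smul _ _ _
    · simp only [State.dual_mk, State.dual_smul, State.aux_smul, State.primal_smul,
        PiLp.smul_apply, lap_smul, Game.mulA, map_smul, smul_sub, RingHom.id_apply]

lemma extOp_sub (v w : State n m) : extOp G W F v - extOp G W F w
    = State.mk (F v.primal - F w.primal) 0 0 + extLin G W (v - w) := by
  rw [map_sub]
  refine State.ext_blocks (fun i => ?_) (fun i => ?_) fun i => ?_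
  · simp only [extOp, extLin, LinearMap.coe_mk, AddHom.coe_mk, State.primal_sub, State.primal_add,
      State.primal_mk, PiLp.sub_apply, PiLp.add_apply]
    abel
  · simp only [extOp, extLin, LinearMap.coe_mk, AddHom.coe_mk, State.aux_sub, State.aux_add,
      State.aux_mk, PiLp.sub_apply, PiLp.add_apply, PiLp.zero_apply]
    abel
  · simp only [extOp, extLin, LinearMap.coe_mk, AddHom.coe_mk, State.dual_sub, State.dual_add,
      State.dual_mk, PiLp.sub_apply, PiLp.add_apply, PiLp.zero_apply]
    abel

/-- This makes `lipConst` meaningful: as an infimum of an empty set of constants it would be zero.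
-/
lemma extOp_exists_lipschitz {ℓF : ℝ} (hℓF : 0 ≤ ℓF) (hF : ∀ x y, ‖F x - F y‖ ≤ ℓF * ‖x - y‖) :
    ∃ ℓ : ℝ, 0 ≤ ℓ ∧ ∀ v w : State n m, ‖extOp G W F v - extOp G W F w‖ ≤ ℓ * ‖v - w‖ := by
  let Λ := LinearMap.toContinuousLinearMap (extLin G W : State n m →ₗ[ℝ] State n m)
  refine ⟨ℓF + ‖Λ‖, by positivity, fun v w => ?_⟩
  rw [extOp_sub, add_mul]
  refine (norm_add_le _ _).trans (add_le_add ?_ (Λ.le_opNorm _))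
  rw [State.norm_mk_zero]
  refine (hF _ _).trans ?_
  gcongr
  exact State.norm_primal_le (v - w)

end ExtOp

lemma lipConst_nonneg {E : Type*} [NormedAddCommGroup E] (T : E → E) : 0 ≤ lipConst T :=
  Real.sInf_nonneg fun _ h => h.1

/-- The least Lipschitz constant of a Lipschitz map is attained. -/
lemma norm_sub_le_lipConst {E : Type*} [NormedAddCommGroup E] {T : E → E}
    (hT : ∃ ℓ : ℝ, 0 ≤ ℓ ∧ ∀ u v, ‖T u - T v‖ ≤ ℓ * ‖u - v‖) (u v : E) :
    ‖T u - T v‖ ≤ lipConst T * ‖u - v‖ := by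
  rcases (norm_nonneg (u - v)).eq_or_lt with h | h
  · obtain ⟨ℓ, _, hℓ⟩ := hT
    have := hℓ u v
    rw [← h, mul_zero] at this ⊢
    exact this
  · rw [← div_le_iff₀ h]
    refine le_csInf hT fun ℓ hℓ => ?_
    rw [div_le_iff₀ h]
    exact hℓ.2 u v

/-! ### Equivalence of the game's and the extended variational inequality -/

section KKT

variable {N : ℕ} {n : Fin N → ℕ} {m d : ℕ} (G : Game n m d) {W : Matrix (Fin N) (Fin N) ℝ}
  {F : Profile n → Profile n}

lemma Game.inner_sum_mulA (x : Profile n) (l : EuclideanSpace ℝ (Fin m)) :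
    ⟪l, ∑ i, G.mulA i (x i)⟫ = ∑ i, ⟪G.mulAT i l, x i⟫ := by
  rw [inner_sum]
  exact Finset.sum_congr rfl fun i _ => (G.inner_mulAT i _ _).symm

/-- The primal block of a solution of the extended variational inequality solves the variational
inequality of the game. -/
lemma primal_of_extOp_solution (hW : GraphAssumption W) {w : State n m} (hw : w ∈ G.stateSet)
    (hsol : ∀ c ∈ G.stateSet, 0 ≤ ⟪extOp G W F w, c - w⟫) :
    w.primal ∈ G.feasible ∧ ∀ y ∈ G.feasible, 0 ≤ ⟪F w.primal, y - w.primal⟫ := by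
  obtain ⟨i₀⟩ := hW.connected.nonempty
  -- The auxiliary block is unconstrained, so it may be moved by `-𝐋 λ`, which gives `-‖𝐋 λ‖ ^ 2 ≥
  -- 0`.
  have haux : ∀ i, lap W w.dual i = 0 := by
    have h := hsol (State.mk w.primal (w.aux - WithLp.toLp 2 fun i => lap W w.dual i) w.dual)
      ⟨hw.1, hw.2⟩
    rw [State.inner_eq_sum] at h
    simp only [extOp, State.primal_sub, State.aux_sub, State.dual_sub, State.primal_mk,
      State.aux_mk, State.dual_mk, sub_self, PiLp.zero_apply, PiLp.neg_apply, inner_zero_right,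
      Finset.sum_const_zero, zero_add, add_zero, sub_sub_cancel_left, inner_neg_right,
      Finset.sum_neg_distrib] at h
    intro i
    have h2 := (Finset.sum_eq_zero_iff_of_nonneg fun i _ =>
      real_inner_self_nonneg (x := lap W w.dual i)).1 (le_antisymm (by linarith)
        (Finset.sum_nonneg fun i _ => real_inner_self_nonneg)) i (Finset.mem_univ i)
    exact inner_self_eq_zero.1 h2
  have hcons := consensus_of_lap_eq_zero hW haux
  obtain ⟨l, hl⟩ : ∃ l, l = w.dual i₀ := ⟨_, rfl⟩
  have hwl : ∀ i, w.dual i = l := fun i => by rw [hl]; exact hcons i i₀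
  have hlo : l ∈ orthant m := hl ▸ hw.2 i₀
  obtain ⟨s, hs⟩ : ∃ s, s = ∑ i, G.b i - ∑ i, G.mulA i (w.primal i) := ⟨_, rfl⟩
  -- Testing with the same `μ` for all agents sums the dual rows, and the term `𝐋 z` disappears
  -- because its blocks sum to zero. Varying `μ` then yields feasibility and complementary
  -- slackness.
  have hdual : ∀ μ ∈ orthant m, 0 ≤ ⟪s, μ - l⟫ := by
    intro μ hμ
    have h := hsol (State.mk w.primal w.aux (WithLp.toLp 2 fun _ => μ)) ⟨hw.1, fun _ => hμ⟩
    rw [State.inner_eq_sum] at h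
    simp only [extOp, State.primal_sub, State.aux_sub, State.dual_sub, State.primal_mk,
      State.aux_mk, State.dual_mk, PiLp.sub_apply, sub_self, PiLp.zero_apply, inner_zero_right,
      Finset.sum_const_zero, zero_add, hwl, haux] at h
    rw [← sum_inner, Finset.sum_sub_distrib, Finset.sum_sub_distrib, sum_lap hW, sub_zero,
      ← hs] at h
    exact h
  have hs0 : ∀ r, 0 ≤ s r := by
    intro r
    have h := hdual (l + EuclideanSpace.single r 1) fun q => by
      rw [PiLp.add_apply, PiLp.single_apply]
      have := hlo q
      split_ifs <;> linarith
    rw [add_sub_cancel_left, EuclideanSpace.inner_single_right] at h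
    simpa using h
  have hsl : ⟪s, l⟫ ≤ 0 := by
    have h := hdual 0 fun q => le_rfl
    rw [zero_sub, inner_neg_right] at h
    linarith
  have hfeas : w.primal ∈ G.feasible := ⟨hw.1, fun r => by
    have := hs0 r
    rw [hs, PiLp.sub_apply] at this
    linarith⟩
  refine ⟨hfeas, fun y hy => ?_⟩
  have h := hsol (State.mk y w.aux w.dual) ⟨hy.1, hw.2⟩
  rw [State.inner_eq_sum] at h
  simp only [extOp, State.primal_sub, State.aux_sub, State.dual_sub, State.primal_mk,
    State.aux_mk, State.dual_mk, sub_self, inner_zero_right, PiLp.zero_apply,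
    Finset.sum_const_zero, add_zero, inner_add_left, Finset.sum_add_distrib, hwl] at h
  rw [← G.inner_sum_mulA, ← PiLp.inner_apply] at h
  have h2 : ∑ i, G.mulA i ((y - w.primal) i)
      = s - (∑ i, G.b i - ∑ i, G.mulA i (y i)) := by
    simp only [PiLp.sub_apply, G.mulA_sub, Finset.sum_sub_distrib, hs]
    abel
  have h3 : 0 ≤ ⟪l, ∑ i, G.b i - ∑ i, G.mulA i (y i)⟫ := by
    rw [PiLp.inner_apply]
    refine Finset.sum_nonneg fun r _ => ?_
    have := hy.2 r
    simp only [PiLp.sub_apply, RCLike.inner_apply, conj_trivial]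
    exact mul_nonneg (by linarith) (hlo r)
  rw [h2, inner_sub_right l s, real_inner_comm s l] at h
  linarith

/-- Under Slater's condition a solution of the variational inequality of the game extends to a
solution of the extended variational inequality. -/
lemma exists_extOp_solution (hW : GraphAssumption W) (hX : G.ConstraintAssumption) {x : Profile n}
    (hx : x ∈ G.feasible) (hsol : ∀ y ∈ G.feasible, 0 ≤ ⟪F x, y - x⟫) :
    ∃ w ∈ G.stateSet, w.primal = x ∧ ∀ c ∈ G.stateSet, 0 ≤ ⟪extOp G W F w, c - w⟫ := by
  obtain ⟨i₀⟩ := hW.connected.nonempty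
  have hN : (N : ℝ) ≠ 0 := by
    have := i₀.pos
    positivity
  have hconv : Convex ℝ G.localSet := fun u hu v hv a b ha hb hab i =>
    hX.convex i (hu i) (hv i) ha hb hab
  obtain ⟨s, hsΩ, hs⟩ := hX.slater
  -- The multiplier belongs to the linearised program that minimises `⟪F x, y - x⟫` over feasible
  -- `y`; its value is zero, attained at `x`.
  obtain ⟨μ, hμ, hmain⟩ := exists_lagrange_multiplier (Ω := G.localSet)
    (f := fun y => ⟪F x, y - x⟫) (g := fun y r => (∑ i, G.mulA i (y i)) r - (∑ i, G.b i) r)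
    ⟨hconv, fun u _ v _ a b _ _ hab => by
      have : a • u + b • v - x = a • (u - x) + b • (v - x) := by
        rw [smul_sub, smul_sub]
        nth_rewrite 1 [← one_smul ℝ x]
        rw [← hab, add_smul]; abel
      simp only [this, inner_add_right, real_inner_smul_right, smul_eq_mul, le_refl]⟩
    (fun r => ⟨hconv, fun u _ v _ a b _ _ hab => by
      simp only [PiLp.add_apply, PiLp.smul_apply, Game.mulA, map_add, map_smul,
        Finset.sum_add_distrib, ← Finset.smul_sum, smul_eq_mul]
      rw [mul_sub, mul_sub]
      nth_rewrite 1 [← one_mul ((∑ i, G.b i).ofLp r)]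
      rw [← hab, add_mul]
      exact le_of_eq (by ring)⟩)
    ⟨s, hsΩ, fun r => by have := hs r; linarith⟩
    (fun y hy h => hsol y ⟨hy, fun r => by have := h r; linarith⟩)
  obtain ⟨l, hl⟩ : ∃ l : EuclideanSpace ℝ (Fin m), l = WithLp.toLp 2 μ := ⟨_, rfl⟩
  have hlo : l ∈ orthant m := fun r => by rw [hl]; exact hμ r
  obtain ⟨g, hg⟩ : ∃ g, g = ∑ i, G.mulA i (x i) - ∑ i, G.b i := ⟨_, rfl⟩
  have hmain' : ∀ y ∈ G.localSet,
      0 ≤ ⟪F x, y - x⟫ + ⟪l, ∑ i, G.mulA i (y i) - ∑ i, G.b i⟫ := by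
    intro y hy
    have := hmain y hy
    rw [PiLp.inner_apply (𝕜 := ℝ) l]
    simp only [hl, PiLp.sub_apply, RCLike.inner_apply, conj_trivial]
    simpa only [mul_comm] using this
  have hg0 : ∀ r, g r ≤ 0 := fun r => by
    have := hx.2 r
    rw [hg, PiLp.sub_apply]; linarith
  have hlg : ⟪l, g⟫ = 0 := by
    apply le_antisymm
    · rw [PiLp.inner_apply]
      refine Finset.sum_nonpos fun r _ => ?_
      simp only [RCLike.inner_apply, conj_trivial]
      exact mul_nonpos_of_nonpos_of_nonneg (hg0 r) (hlo r)
    · have := hmain' x hx.1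
      rw [sub_self, inner_zero_right, zero_add, ← hg] at this
      exact this
  -- The local residuals `A_i x_i - b_i` differ between agents. Their deviations from the mean sum
  -- to zero, so some `z` evens them out, leaving `-g / N` in every dual row.
  obtain ⟨z, hz⟩ := exists_lap_eq hW
    (WithLp.toLp 2 fun i => (1 / (N : ℝ)) • g - (G.mulA i (x i) - G.b i)) (by
      simp only [Finset.sum_sub_distrib, Finset.sum_const, Finset.card_univ, Fintype.card_fin]
      rw [← hg, ← Nat.cast_smul_eq_nsmul ℝ, smul_smul, mul_one_div_cancel hN, one_smul, sub_self])
  have hz : ∀ i, lap W z i = (1 / (N : ℝ)) • g - (G.mulA i (x i) - G.b i) := hz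
  refine ⟨State.mk x z (WithLp.toLp 2 fun _ => l), ⟨hx.1, fun _ => hlo⟩, rfl, fun c hc => ?_⟩
  have hlap : ∀ i, lap W (WithLp.toLp 2 fun _ => l : Dual N m) i = 0 :=
    lap_of_consensus fun _ _ => rfl
  rw [State.inner_eq_sum]
  simp only [extOp, State.primal_sub, State.aux_sub, State.dual_sub, State.primal_mk,
    State.aux_mk, State.dual_mk, hlap, hz, inner_zero_left, Finset.sum_const_zero, zero_add,
    inner_add_left, Finset.sum_add_distrib]
  rw [← G.inner_sum_mulA, ← PiLp.inner_apply]
  have h1 := hmain' c.primal hc.1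
  have h2 : ∑ i, G.mulA i ((c.primal - x) i) = (∑ i, G.mulA i (c.primal i) - ∑ i, G.b i) - g := by
    simp only [PiLp.sub_apply, G.mulA_sub, Finset.sum_sub_distrib, hg]
    abel
  have h3 : 0 ≤ ∑ i, ⟪G.b i - G.mulA i (x i)
      - ((1 / (N : ℝ)) • g - (G.mulA i (x i) - G.b i)), (c.dual - (WithLp.toLp 2 fun _ => l : Dual N m)) i⟫ := by
    refine Finset.sum_nonneg fun i _ => ?_
    have h4 : G.b i - G.mulA i (x i) - ((1 / (N : ℝ)) • g - (G.mulA i (x i) - G.b i))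
        = -((1 / (N : ℝ)) • g) := by abel
    rw [h4, PiLp.sub_apply, inner_neg_left, real_inner_smul_left, inner_sub_right,
      real_inner_comm l g, hlg, sub_zero]
    have h5 : ⟪g, c.dual i⟫ ≤ 0 := by
      rw [PiLp.inner_apply]
      refine Finset.sum_nonpos fun r _ => ?_
      simp only [RCLike.inner_apply, conj_trivial]
      exact mul_nonpos_of_nonneg_of_nonpos (hc.2 i r) (hg0 r)
    have : 0 ≤ 1 / (N : ℝ) := by positivity
    have := mul_nonpos_of_nonneg_of_nonpos this h5
    linarith
  rw [h2, inner_sub_right l, hlg, sub_zero]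
  linarith

end KKT

/-! ### Projections onto closed convex sets -/

section Proj

variable {E : Type*} [NormedAddCommGroup E] [InnerProductSpace ℝ E] [CompleteSpace E] {C : Set E}

lemma proj_spec (hne : C.Nonempty) (hcl : IsClosed C) (hco : Convex ℝ C) (v : E) :
    proj C v ∈ C ∧ ∀ q ∈ C, ⟪v - proj C v, q - proj C v⟫ ≤ 0 := by
  have hex : ∃ p, p ∈ C ∧ ∀ q ∈ C, ‖p - v‖ ≤ ‖q - v‖ := by
    obtain ⟨p, hp, hpv⟩ := exists_norm_eq_iInf_of_complete_convex hne hcl.isComplete hco v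
    refine ⟨p, hp, fun q hq => ?_⟩
    rw [norm_sub_rev, hpv, norm_sub_rev]
    exact ciInf_le ⟨0, by rintro _ ⟨w, rfl⟩; exact norm_nonneg _⟩ (⟨q, hq⟩ : C)
  have hspec : proj C v ∈ C ∧ ∀ q ∈ C, ‖proj C v - v‖ ≤ ‖q - v‖ := Classical.epsilon_spec hex
  refine ⟨hspec.1, (norm_eq_iInf_iff_real_inner_le_zero hco hspec.1).1 ?_⟩
  have : Nonempty C := ⟨⟨_, hspec.1⟩⟩
  apply le_antisymm
  · refine le_ciInf fun w => ?_
    rw [norm_sub_rev, norm_sub_rev v]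
    exact hspec.2 w w.2
  · exact ciInf_le ⟨0, by rintro _ ⟨w, rfl⟩; exact norm_nonneg _⟩ (⟨_, hspec.1⟩ : C)

lemma continuous_proj (hne : C.Nonempty) (hcl : IsClosed C) (hco : Convex ℝ C) :
    Continuous (proj C) := by
  refine (LipschitzWith.of_dist_le_mul (K := 1) fun v w => ?_).continuous
  rw [dist_eq_norm, dist_eq_norm, NNReal.coe_one, one_mul]
  obtain ⟨h1, h2⟩ := proj_spec hne hcl hco v
  obtain ⟨h3, h4⟩ := proj_spec hne hcl hco w
  have h5 := h2 _ h3
  have h6 := h4 _ h1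
  generalize proj C v = p at *
  generalize proj C w = q at *
  have h7 : ‖p - q‖ ^ 2 ≤ ⟪v - w, p - q⟫ := by
    have : ⟪v - p, q - p⟫ + ⟪w - q, p - q⟫ = ‖p - q‖ ^ 2 - ⟪v - w, p - q⟫ := by
      rw [← neg_sub p q, inner_neg_right, ← real_inner_self_eq_norm_sq]
      simp only [inner_sub_left]
      ring
    linarith
  have h8 := real_inner_le_norm (v - w) (p - q)
  rcases (norm_nonneg (p - q)).eq_or_lt with h | h
  · rw [← h]; exact norm_nonneg _
  · nlinarith

end Proj

section Orthant

variable (m : ℕ)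

lemma orthant_nonempty : (orthant m).Nonempty := ⟨0, fun _ => le_rfl⟩

lemma isClosed_orthant : IsClosed (orthant m) := by
  have : orthant m = ⋂ r, {v | 0 ≤ v r} := by ext; simp [orthant]
  rw [this]
  exact isClosed_iInter fun r => isClosed_le continuous_const (by fun_prop)

lemma convex_orthant : Convex ℝ (orthant m) := fun u hu v hv a b ha hb _ r => by
  have := mul_nonneg ha (hu r)
  have := mul_nonneg hb (hv r)
  simp only [PiLp.add_apply, PiLp.smul_apply, smul_eq_mul]
  linarith

end Orthant

/-! ### Blockwise scaling by step sizes -/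

section Scaling

variable {N : ℕ} {n : Fin N → ℕ} {m : ℕ}

/-- Blockwise scaling of a state. -/
noncomputable def blockScale (a b c : Fin N → ℝ) : State n m →ₗ[ℝ] State n m where
  toFun w := State.mk (WithLp.toLp 2 fun i => a i • w.primal i)
    (WithLp.toLp 2 fun i => b i • w.aux i) (WithLp.toLp 2 fun i => c i • w.dual i)
  map_add' _ _ := State.ext_blocks (fun _ => smul_add _ _ _) (fun _ => smul_add _ _ _)
    fun _ => smul_add _ _ _
  map_smul' r w := State.ext_blocks (fun i => smul_comm (a i) r (w.primal i))
    (fun i => smul_comm (b i) r (w.aux i)) fun i => smul_comm (c i) r (w.dual i)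

variable {a b c : Fin N → ℝ}

@[simp] lemma blockScale_primal (w : State n m) (i : Fin N) :
    (blockScale a b c w).primal i = a i • w.primal i := rfl
@[simp] lemma blockScale_aux (w : State n m) (i : Fin N) :
    (blockScale a b c w).aux i = b i • w.aux i := rfl
@[simp] lemma blockScale_dual (w : State n m) (i : Fin N) :
    (blockScale a b c w).dual i = c i • w.dual i := rfl

lemma inner_blockScale (v w : State n m) :
    ⟪blockScale a b c v, w⟫ = ⟪v, blockScale a b c w⟫ := by
  simp only [State.inner_eq_sum, blockScale_primal, blockScale_aux, blockScale_dual,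
    real_inner_smul_left, real_inner_smul_right]

lemma blockScale_comp (a' b' c' : Fin N → ℝ) (w : State n m) :
    blockScale a b c (blockScale a' b' c' w) = blockScale (a * a') (b * b') (c * c') w :=
  State.ext_blocks (fun _ => smul_smul _ _ _) (fun _ => smul_smul _ _ _) fun _ => smul_smul _ _ _

lemma blockScale_one (w : State n m) : blockScale 1 1 1 w = w :=
  State.ext_blocks (fun _ => one_smul _ _) (fun _ => one_smul _ _) fun _ => one_smul _ _

lemma norm_blockScale_le {γ : ℝ} (hγ : 0 ≤ γ) (ha : ∀ i, a i ^ 2 ≤ γ) (hb : ∀ i, b i ^ 2 ≤ γ)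
    (hc : ∀ i, c i ^ 2 ≤ γ) (w : State n m) : ‖blockScale a b c w‖ ≤ √γ * ‖w‖ := by
  apply le_of_sq_le_sq _ (by positivity)
  rw [mul_pow, Real.sq_sqrt hγ]
  simp only [← real_inner_self_eq_norm_sq, State.inner_eq_sum, mul_add, Finset.mul_sum,
    blockScale_primal, blockScale_aux, blockScale_dual, real_inner_smul_left,
    real_inner_smul_right, ← mul_assoc, ← sq]
  refine add_le_add ?_ (add_le_add ?_ ?_) <;>
  refine Finset.sum_le_sum fun i _ => mul_le_mul_of_nonneg_right ?_ real_inner_self_nonneg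
  exacts [ha i, hb i, hc i]

end Scaling

/-! ### One iteration as a variational inequality, and pathwise convergence -/

section Step

variable {N : ℕ} {n : Fin N → ℕ} {m d : ℕ} (G : Game n m d) {W : Matrix (Fin N) (Fin N) ℝ}
  {F Fhat : Profile n → Profile n} {α ν τ : Fin N → ℝ}

lemma sprgStep_mem (hX : G.ConstraintAssumption) (wprev w : State n m) :
    sprgStep G W α ν τ Fhat wprev w ∈ G.stateSet :=
  ⟨fun i => (proj_spec (hX.nonempty i) (hX.compact i).isClosed (hX.convex i) _).1,
    fun _ => (proj_spec (orthant_nonempty m) (isClosed_orthant m) (convex_orthant m) _).1⟩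

/-- One iteration of the algorithm as a variational inequality for the extended operator. -/
lemma sprgStep_inner_le (hX : G.ConstraintAssumption) (hα : ∀ i, 0 < α i) (hν : ∀ i, 0 < ν i)
    (hτ : ∀ i, 0 < τ i) {wprev w w' wt : State n m} (hwt : wt = (2 : ℝ) • w - wprev)
    (hw' : w' = sprgStep G W α ν τ Fhat wprev w) {c : State n m} (hc : c ∈ G.stateSet) :
    ⟪blockScale α⁻¹ ν⁻¹ τ⁻¹ (w - w') - extOp G W F wt
      - State.mk (Fhat wt.primal - F wt.primal) 0 0, c - w'⟫ ≤ 0 := by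
  have key : ∀ {k : ℕ} {s : ℝ} (_ : 0 < s) {p g p' q : EuclideanSpace ℝ (Fin k)}
      (_ : ⟪p - s • g - p', q - p'⟫ ≤ 0), ⟪s⁻¹ • (p - p') - g, q - p'⟫ ≤ 0 := by
    intro k s hs p g p' q h
    have h1 : s⁻¹ • (p - p') - g = s⁻¹ • (p - s • g - p') := by
      rw [sub_right_comm, smul_sub s⁻¹ (p - p'), inv_smul_smul₀ hs.ne']
    rw [h1, real_inner_smul_left]
    exact mul_nonpos_of_nonneg_of_nonpos (inv_nonneg.2 hs.le) h
  rw [State.inner_eq_sum]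
  refine add_nonpos (Finset.sum_nonpos fun i _ => ?_)
    (add_nonpos (Finset.sum_nonpos fun i _ => ?_) (Finset.sum_nonpos fun i _ => ?_))
  · have h := key (hα i) ((proj_spec (hX.nonempty i) (hX.compact i).isClosed (hX.convex i)
      (w.primal i - α i • (Fhat wt.primal i + G.mulAT i (wt.dual i)))).2 _ (hc.1 i))
    have h1 : w'.primal i
        = proj (G.Ω i) (w.primal i - α i • (Fhat wt.primal i + G.mulAT i (wt.dual i))) := by
      rw [hw', hwt]; rfl
    rw [← h1] at h
    refine le_of_eq_of_le (congrArg (fun v => ⟪v, (c - w').primal i⟫) ?_) h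
    simp only [extOp, State.primal_sub, PiLp.sub_apply, blockScale_primal, State.primal_mk,
      Pi.inv_apply]
    abel
  -- The auxiliary update involves no projection, so its residual vanishes exactly.
  · have h1 : w'.aux i = w.aux i - ν i • lap W wt.dual i := by
      rw [hw', hwt]; rfl
    have h2 : (blockScale α⁻¹ ν⁻¹ τ⁻¹ (w - w') - extOp G W F wt
        - State.mk (Fhat wt.primal - F wt.primal) 0 0).aux i = 0 := by
      simp only [extOp, State.aux_sub, PiLp.sub_apply, blockScale_aux, State.aux_mk,
        Pi.inv_apply, h1, PiLp.zero_apply, sub_sub_cancel]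
      rw [inv_smul_smul₀ (hν i).ne', sub_self, sub_zero]
    rw [h2, inner_zero_left]
  · have h1 : w'.dual i = proj (orthant m) (w.dual i - τ i • (lap W wt.dual i + G.b i
        - G.mulA i (wt.primal i) - lap W wt.aux i)) := by
      have h2 : w.dual i - τ i • (lap W wt.dual i + G.b i - G.mulA i (wt.primal i) - lap W wt.aux i)
          = w.dual i + τ i • (G.mulA i (wt.primal i) - G.b i)
            + τ i • ∑ j, W i j • ((wt.aux i - wt.aux j) - (wt.dual i - wt.dual j)) := by
        have h3 : ∑ j, W i j • ((wt.aux i - wt.aux j) - (wt.dual i - wt.dual j))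
            = lap W wt.aux i - lap W wt.dual i := by
          simp only [lap, smul_sub, Finset.sum_sub_distrib]
        rw [h3]
        module
      rw [h2, hw', hwt]; rfl
    have h := key (hτ i) ((proj_spec (orthant_nonempty m) (isClosed_orthant m) (convex_orthant m)
      (w.dual i - τ i • (lap W wt.dual i + G.b i - G.mulA i (wt.primal i) - lap W wt.aux i))).2 _
      (hc.2 i))
    rw [← h1] at h
    refine le_of_eq_of_le (congrArg (fun v => ⟪v, (c - w').dual i⟫) ?_) h
    simp only [extOp, State.dual_sub, PiLp.sub_apply, blockScale_dual, State.dual_mk,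
      Pi.inv_apply, sub_zero]

lemma isClosed_stateSet (hX : G.ConstraintAssumption) : IsClosed (G.stateSet : Set (State n m)) := by
  have : G.stateSet = (⋂ i, {w : State n m | w.primal i ∈ G.Ω i})
      ∩ ⋂ i, {w : State n m | w.dual i ∈ orthant m} := by
    ext; simp [Game.stateSet]
  rw [this]
  refine (isClosed_iInter fun i => ?_).inter (isClosed_iInter fun i => ?_)
  · exact (hX.compact i).isClosed.preimage
      ((PiLp.continuous_apply 2 _ i).comp State.continuous_primal)
  · exact (isClosed_orthant m).preimage
      ((PiLp.continuous_apply 2 _ i).comp State.continuous_dual)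

lemma continuous_extOp (hF : Continuous F) : Continuous (extOp (m := m) G W F) := by
  have h : extOp (m := m) G W F = fun w => State.mk (F w.primal) 0 0
      + (extLin G W w + (extOp G W (fun _ => 0) 0)) := by
    funext w
    have h2 := extOp_sub G (W := W) (F := fun _ => 0) w 0
    simp only [sub_self] at h2
    have h3 : extOp G W F w = State.mk (F w.primal) 0 0 + extOp G W (fun _ => 0) w :=
      State.ext_blocks (fun i => by simp [extOp]) (fun i => by simp [extOp])
        fun i => by simp [extOp]
    rw [h3]
    congr 1
    rw [sub_zero] at h2
    rw [eq_add_of_sub_eq h2]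
    congr 1
    exact zero_add _
  rw [h]
  refine Continuous.add ?_ (Continuous.add ?_ continuous_const)
  · exact State.continuous_mk.comp ((hF.comp State.continuous_primal).prodMk
      (continuous_const (y := ((0, 0) : Dual N m × Dual N m))))
  · exact LinearMap.continuous_of_finiteDimensional _

/-- Pathwise convergence of the algorithm, given control of the accumulated errors. -/
theorem sprg_tendsto_of_errors (hX : G.ConstraintAssumption) (hW : GraphAssumption W)
    (hmono : ∀ x y, 0 ≤ ⟪F x - F y, x - y⟫) {ℓF : ℝ} (hℓF : 0 ≤ ℓF)
    (hlip : ∀ x y, ‖F x - F y‖ ≤ ℓF * ‖x - y‖)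
    (hα : ∀ i, 0 < α i ∧ α i * lipConst (extOp G W F) < √2 - 1)
    (hν : ∀ i, 0 < ν i ∧ ν i * lipConst (extOp G W F) < √2 - 1)
    (hτ : ∀ i, 0 < τ i ∧ τ i * lipConst (extOp G W F) < √2 - 1)
    {x : Profile n} (hx : x ∈ G.feasible) (hsol : ∀ y ∈ G.feasible, 0 ≤ ⟪F x, y - x⟫)
    (huniq : ∀ x' ∈ G.feasible, (∀ y ∈ G.feasible, 0 ≤ ⟪F x', y - x'⟫) → x' = x)
    {p : ℕ → State n m × State n m} {Fh : ℕ → Profile n → Profile n}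
    (hp : ∀ k, p (k + 1) = ((p k).2, sprgStep G W α ν τ (Fh k) (p k).1 (p k).2))
    (hp0 : (p 0).2 ∈ G.stateSet) {xt ε : ℕ → Profile n}
    (hxt : ∀ k, xt k = (2 : ℝ) • (p k).2.primal - (p k).1.primal)
    (hε : ∀ k, ε k = Fh k (xt k) - F (xt k)) {R : ℝ}
    (hR : ∀ N, -R ≤ ∑ k ∈ Finset.range N, ⟪ε (k + 1), xt (k + 1) - x⟫)
    (hsum : Summable fun k => ‖ε k‖ ^ 2) :
    Tendsto (fun k => (p k).2.primal) atTop (𝓝 x) := by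
  obtain ⟨i₀⟩ := hW.connected.nonempty
  obtain ⟨w, hw, hwx, hwsol⟩ := exists_extOp_solution G hW hX hx hsol
  -- The largest of the finitely many step sizes is one of them, so it inherits the strict bound.
  obtain ⟨γ, hγ0, hγα, hγν, hγτ, hγ⟩ : ∃ γ : ℝ, 0 < γ ∧ (∀ i, α i ≤ γ) ∧ (∀ i, ν i ≤ γ) ∧
      (∀ i, τ i ≤ γ) ∧ γ * lipConst (extOp G W F) < √2 - 1 := by
    have : Nonempty (Fin N) := ⟨i₀⟩
    obtain ⟨i₁, h1⟩ := Finite.exists_max fun i => max (α i) (max (ν i) (τ i))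
    refine ⟨max (α i₁) (max (ν i₁) (τ i₁)), lt_max_of_lt_left (hα i₁).1,
      fun i => (le_max_left _ _).trans (h1 i),
      fun i => ((le_max_left _ _).trans (le_max_right _ _)).trans (h1 i),
      fun i => ((le_max_right _ _).trans (le_max_right _ _)).trans (h1 i), ?_⟩
    rcases max_choice (α i₁) (max (ν i₁) (τ i₁)) with h | h <;> rw [h]
    · exact (hα i₁).2
    · rcases max_choice (ν i₁) (τ i₁) with h | h <;> rw [h]
      · exact (hν i₁).2
      · exact (hτ i₁).2
  have hsq : ∀ {s : Fin N → ℝ}, (∀ i, 0 < s i) → ∀ i, √(s i) * √(s i) = s i := fun hs i =>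
    Real.mul_self_sqrt (hs i).le
  have hsne : ∀ {s : Fin N → ℝ}, (∀ i, 0 < s i) → ∀ i, √(s i) ≠ 0 := fun hs i =>
    (Real.sqrt_pos.2 (hs i)).ne'
  -- Square roots of the step sizes keep the conjugated operator `S ∘ extOp ∘ S` monotone, since `S`
  -- is symmetric; scaling `extOp` on one side only would not.
  let S : State n m →ₗ[ℝ] State n m :=
    blockScale (fun i => √(α i)) (fun i => √(ν i)) (fun i => √(τ i))
  let S' : State n m →ₗ[ℝ] State n m :=
    blockScale (fun i => √(α i))⁻¹ (fun i => √(ν i))⁻¹ (fun i => √(τ i))⁻¹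
  have hinv : ∀ {s : Fin N → ℝ}, (∀ i, 0 < s i) →
      (fun i => √(s i)) * (fun i => √(s i))⁻¹ = 1 := fun hs =>
    funext fun i => mul_inv_cancel₀ (hsne hs i)
  have hSS' : ∀ v, S (S' v) = v := fun v => by
    simp only [S, S', blockScale_comp]
    rw [hinv fun i => (hα i).1, hinv fun i => (hν i).1, hinv fun i => (hτ i).1, blockScale_one]
  have hS'S : ∀ v, S' (S v) = v := fun v => by
    simp only [S, S', blockScale_comp]
    rw [mul_comm, hinv fun i => (hα i).1, mul_comm, hinv fun i => (hν i).1, mul_comm,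
      hinv fun i => (hτ i).1, blockScale_one]
  have hSΦ : ∀ v, S (blockScale α⁻¹ ν⁻¹ τ⁻¹ v) = S' v := fun v => by
    have : ∀ {s : Fin N → ℝ}, (∀ i, 0 < s i) →
        (fun i => √(s i)) * s⁻¹ = (fun i => √(s i))⁻¹ := fun {s} hs => funext fun i => by
      have h1 := hsq hs i
      have h2 := hsne hs i
      simp only [Pi.mul_apply, Pi.inv_apply]
      nth_rewrite 2 [← h1]
      field_simp
    simp only [S, S', blockScale_comp]
    rw [this fun i => (hα i).1, this fun i => (hν i).1, this fun i => (hτ i).1]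
  have hSinner : ∀ v w, ⟪S v, w⟫ = ⟪v, S w⟫ := fun v w => inner_blockScale v w
  have hSnorm : ∀ v, ‖S v‖ ≤ √γ * ‖v‖ := fun v =>
    norm_blockScale_le hγ0.le (fun i => by rw [sq, hsq fun i => (hα i).1]; exact hγα i)
      (fun i => by rw [sq, hsq fun i => (hν i).1]; exact hγν i)
      (fun i => by rw [sq, hsq fun i => (hτ i).1]; exact hγτ i) v
  have hScont : Continuous S := LinearMap.continuous_of_finiteDimensional _
  have hFc : Continuous F := by
    refine (LipschitzWith.of_dist_le_mul (K := ⟨ℓF, hℓF⟩) fun x y => ?_).continuous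
    rw [dist_eq_norm, dist_eq_norm]
    exact hlip x y
  let T : State n m → State n m := fun v => S (extOp G W F (S v))
  let C : Set (State n m) := S ⁻¹' G.stateSet
  let u : ℕ → State n m := fun k => S' (p k).2
  let y : ℕ → State n m := fun k => S' ((2 : ℝ) • (p k).2 - (p k).1)
  let e : ℕ → State n m := fun k => S (State.mk (ε k) 0 0)
  have hmem : ∀ k, (p k).2 ∈ G.stateSet := fun k => by
    rcases k with _ | k
    · exact hp0
    · rw [hp k]; exact sprgStep_mem G hX _ _
  have hTmono : ∀ v v', 0 ≤ ⟪T v - T v', v - v'⟫ := fun v v' => by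
    simp only [T]
    rw [← map_sub, hSinner, map_sub]
    exact extOp_monotone G hW hmono _ _
  have hTlip : ∀ v v', ‖T v - T v'‖ ≤ (γ * lipConst (extOp G W F)) * ‖v - v'‖ := fun v v' => by
    simp only [T]
    rw [← map_sub]
    calc _ ≤ √γ * (lipConst (extOp G W F) * (√γ * ‖v - v'‖)) := by
          refine (hSnorm _).trans ?_
          gcongr
          refine (norm_sub_le_lipConst (extOp_exists_lipschitz G hℓF hlip) _ _).trans ?_
          rw [← map_sub]
          exact mul_le_mul_of_nonneg_left (hSnorm _) (lipConst_nonneg _)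
      _ = (√γ * √γ) * lipConst (extOp G W F) * ‖v - v'‖ := by ring
      _ = _ := by rw [Real.mul_self_sqrt hγ0.le]
  have hu : ∀ k, u k ∈ C := fun k => by
    change S (S' (p k).2) ∈ G.stateSet
    rw [hSS']; exact hmem k
  have hy : ∀ k, y (k + 1) = (2 : ℝ) • u (k + 1) - u k := fun k => by
    simp only [y, u, map_sub, map_smul]
    rw [hp k]
  have hVI : ∀ k, ∀ c ∈ C, ⟪u k - T (y k) - e k - u (k + 1), c - u (k + 1)⟫ ≤ 0 := by
    intro k c hc
    have h := sprgStep_inner_le (F := F) (Fhat := Fh k) G hX (fun i => (hα i).1)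
      (fun i => (hν i).1) (fun i => (hτ i).1) (wt := (2 : ℝ) • (p k).2 - (p k).1) rfl
      (w' := (p (k + 1)).2) (by rw [hp k]) hc
    have h1 : u k - T (y k) - e k - u (k + 1)
        = S (blockScale α⁻¹ ν⁻¹ τ⁻¹ ((p k).2 - (p (k + 1)).2)
          - extOp G W F ((2 : ℝ) • (p k).2 - (p k).1) - State.mk (ε k) 0 0) := by
      simp only [map_sub S, hSΦ, u, T, y, e, hSS', map_sub S']
      abel
    rw [h1, hSinner, map_sub S c, hSS', hε k, hxt k]
    exact h
  have hzC : S' w ∈ C := by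
    change S (S' w) ∈ G.stateSet
    rw [hSS']; exact hw
  have hTz : ∀ c ∈ C, 0 ≤ ⟪T (S' w), c - S' w⟫ := fun c hc => by
    simp only [T]
    rw [hSinner, map_sub, hSS']
    exact hwsol _ hc
  -- The factor `S` in the error cancels its inverse in the iterates, so the noise term is unchanged
  -- by the rescaling, and only its primal block survives.
  have hR' : ∀ k, -R ≤ ∑ j ∈ Finset.range k, ⟪e (j + 1), y (j + 1) - S' w⟫ := fun k => by
    refine (hR k).trans (le_of_eq (Finset.sum_congr rfl fun j _ => ?_))
    simp only [e, y]
    rw [hSinner, map_sub S, hSS', hSS', State.inner_eq]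
    simp only [State.primal_mk, State.aux_mk, State.dual_mk, inner_zero_left, add_zero,
      State.primal_sub, State.primal_smul, hwx, hxt]
  have hesum : Summable fun k => ‖e k‖ ^ 2 := by
    refine Summable.of_nonneg_of_le (fun _ => by positivity) (fun k => ?_) (hsum.mul_left γ)
    have := hSnorm (State.mk (ε k) 0 0)
    rw [State.norm_mk_zero] at this
    calc ‖e k‖ ^ 2 ≤ (√γ * ‖ε k‖) ^ 2 := by gcongr
      _ = _ := by rw [mul_pow, Real.sq_sqrt hγ0.le]
  obtain ⟨⟨K, hK⟩, hreg⟩ := reflected_gradient_bounded hTmono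
    (mul_nonneg hγ0.le (lipConst_nonneg _)) hTlip hγ hzC hTz hu hy hVI hR' hesum
  have he0 : Tendsto e atTop (𝓝 0) := by
    have h3 := hesum.tendsto_atTop_zero.sqrt
    simp only [Real.sqrt_zero, Real.sqrt_sq (norm_nonneg _)] at h3
    exact tendsto_zero_iff_norm_tendsto_zero.2 h3
  have hTc : Continuous T := hScont.comp ((continuous_extOp G hFc).comp hScont)
  -- Every subsequence has a further subsequence whose primal block converges to a solution, which
  -- `huniq` identifies with `x`.
  refine tendsto_of_subseq_tendsto fun ns hns => ?_
  obtain ⟨v, -, φ, hφ, hv⟩ := tendsto_subseq_of_bounded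
    (Metric.isBounded_closedBall (x := (0 : State n m)) (r := K))
    (x := u ∘ ns) fun k => mem_closedBall_zero_iff.2 (hK _)
  refine ⟨φ, ?_⟩
  obtain ⟨hvC, hvsol⟩ := reflected_gradient_cluster ((isClosed_stateSet G hX).preimage hScont) hTc
    hu hy hVI hreg he0 (hns.comp hφ.tendsto_atTop) hv
  have hlim : Tendsto (fun k => (p (ns (φ k))).2.primal) atTop (𝓝 (S v).primal) := by
    have := ((State.continuous_primal.comp hScont).tendsto v).comp hv
    simpa only [Function.comp_def, u, hSS'] using this
  obtain ⟨h1, h2⟩ := primal_of_extOp_solution G hW (F := F) (w := S v) hvC fun c hc => by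
    have := hvsol (S' c) (by change S (S' c) ∈ G.stateSet; rw [hSS']; exact hc)
    simp only [T] at this
    rwa [hSinner, map_sub, hSS'] at this
  rwa [huniq _ h1 h2] at hlim

end Step

/-! ### Measurability of gradients and iterates -/

section Measurability

variable {N : ℕ} {n : Fin N → ℕ} {m d : ℕ} (G : Game n m d) {W : Matrix (Fin N) (Fin N) ℝ}

lemma measurable_toLp_euclidean {Ω : Type*} [MeasurableSpace Ω] {k : ℕ}
    {f : Ω → EuclideanSpace ℝ (Fin k)} (hf : ∀ r, Measurable fun ω => f ω r) : Measurable f :=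
  (WithLp.measurable_toLp 2 (Fin k → ℝ)).comp (measurable_pi_lambda _ hf)

lemma measurable_toLp_blocks {Ω : Type*} [MeasurableSpace Ω] {k : Fin N → ℕ}
    {f : (i : Fin N) → Ω → EuclideanSpace ℝ (Fin (k i))} (hf : ∀ i, Measurable (f i)) :
    Measurable fun ω => (WithLp.toLp 2 fun i => f i ω : Profile k) :=
  (WithLp.measurable_toLp 2 ((i : Fin N) → EuclideanSpace ℝ (Fin (k i)))).comp
    (measurable_pi_lambda _ hf)

lemma replace_self (x : Profile n) (i : Fin N) : replace x i (x i) = x := by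
  simp [replace]

lemma replace_apply_self (x : Profile n) (i : Fin N) (y : EuclideanSpace ℝ (Fin (n i))) :
    replace x i y i = y := by
  simp [replace]

lemma replace_apply_ne (x : Profile n) {i j : Fin N} (h : j ≠ i)
    (y : EuclideanSpace ℝ (Fin (n i))) : replace x i y j = x j := by
  simp [replace, h]

lemma replace_add (x : Profile n) (i : Fin N) (v : EuclideanSpace ℝ (Fin (n i))) :
    replace x i (x i + v) = x + replace 0 i v := by
  refine PiLp.ext fun j => ?_
  rw [PiLp.add_apply]
  by_cases h : j = i
  · subst h; rw [replace_apply_self, replace_apply_self]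
  · rw [replace_apply_ne _ h, replace_apply_ne _ h, PiLp.zero_apply, add_zero]

/-- Each partial derivative is a pointwise limit of difference quotients with increment `1 / k`,
which are jointly measurable because `J` is. -/
lemma measurable_gradJ {i : Fin N}
    (hm : Measurable fun p : Profile n × EuclideanSpace ℝ (Fin d) => G.J i p.1 p.2)
    (hs : ∀ x v, ContDiff ℝ 1 fun y => G.J i (replace x i y) v) :
    Measurable fun p : Profile n × EuclideanSpace ℝ (Fin d) => G.gradJ i p.1 p.2 := by
  refine measurable_toLp_euclidean fun r => ?_
  let q : ℕ → Profile n × EuclideanSpace ℝ (Fin d) → ℝ := fun k p =>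
    (k : ℝ) • (G.J i (p.1 + replace 0 i ((k : ℝ)⁻¹ • EuclideanSpace.single r 1)) p.2
      - G.J i p.1 p.2)
  refine measurable_of_tendsto_metrizable (f := q) (fun k => ?_) (tendsto_pi_nhds.2 fun p => ?_)
  · refine Measurable.fun_const_smul (Measurable.fun_sub (hm.comp (Measurable.prodMk
      (g := fun p : Profile n × EuclideanSpace ℝ (Fin d) => p.2) ?_ measurable_snd)) hm) _
    exact measurable_fst.add_const _
  · have hd : HasFDerivAt (fun y => G.J i (replace p.1 i y) p.2)
        (fderiv ℝ (fun y => G.J i (replace p.1 i y) p.2) (p.1 i)) (p.1 i) :=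
      ((hs p.1 p.2).differentiable (by norm_num)).differentiableAt.hasFDerivAt
    have h := hd.lim (EuclideanSpace.single r (1 : ℝ)) (c := fun k : ℕ => (k : ℝ)) (l := atTop)
      (by simpa using tendsto_natCast_atTop_atTop)
    have h2 : G.gradJ i p.1 p.2 r
        = fderiv ℝ (fun y => G.J i (replace p.1 i y) p.2) (p.1 i) (EuclideanSpace.single r 1) := by
      rw [← inner_gradient_left, EuclideanSpace.inner_single_right]
      simp [Game.gradJ]
    rw [h2]
    simpa only [replace_add, replace_self] using h

variable {F : Profile n → Profile n} {α ν τ : Fin N → ℝ} {Ξ : Type*} [MeasurableSpace Ξ]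
  {B : ℕ → ℕ} {S : (k : ℕ) → Fin N → Fin (B k) → Ξ → EuclideanSpace ℝ (Fin d)}

lemma measurable_sampleGrad
    (hm : ∀ i, Measurable fun p : Profile n × EuclideanSpace ℝ (Fin d) => G.J i p.1 p.2)
    (hs : ∀ i x v, ContDiff ℝ 1 fun y => G.J i (replace x i y) v) {k : ℕ}
    (hS : ∀ i s, Measurable (S k i s)) {x : Ξ → Profile n} (hx : Measurable x) :
    Measurable fun θ => sampleGrad G B S k θ (x θ) := by
  refine measurable_toLp_blocks fun i => ?_
  refine Measurable.fun_const_smul (Finset.measurable_fun_sum _ fun s _ => ?_) _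
  exact (measurable_gradJ G (hm i) (hs i)).comp (hx.prodMk (hS i s))

lemma measurable_block {k : Fin N → ℕ} {x : Ξ → Profile k} (hx : Measurable x) (i : Fin N) :
    Measurable fun θ => x θ i :=
  (PiLp.continuous_apply 2 (fun i => EuclideanSpace ℝ (Fin (k i))) i).measurable.comp hx

lemma measurable_sprgStep (hX : G.ConstraintAssumption)
    (hm : ∀ i, Measurable fun p : Profile n × EuclideanSpace ℝ (Fin d) => G.J i p.1 p.2)
    (hs : ∀ i x v, ContDiff ℝ 1 fun y => G.J i (replace x i y) v) {k : ℕ}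
    (hS : ∀ i s, Measurable (S k i s)) {w w' : Ξ → State n m} (hw : Measurable w)
    (hw' : Measurable w') :
    Measurable fun θ => sprgStep G W α ν τ (sampleGrad G B S k θ) (w θ) (w' θ) := by
  have hpr : ∀ {u : Ξ → State n m}, Measurable u → Measurable fun θ => (u θ).primal :=
    fun hu => State.continuous_primal.measurable.comp hu
  have hau : ∀ {u : Ξ → State n m}, Measurable u → Measurable fun θ => (u θ).aux :=
    fun hu => State.continuous_aux.measurable.comp hu
  have hdu : ∀ {u : Ξ → State n m}, Measurable u → Measurable fun θ => (u θ).dual :=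
    fun hu => State.continuous_dual.measurable.comp hu
  have hxt := ((hpr hw').const_smul (2 : ℝ)).sub (hpr hw)
  have hzt := ((hau hw').const_smul (2 : ℝ)).sub (hau hw)
  have hlt := ((hdu hw').const_smul (2 : ℝ)).sub (hdu hw)
  have hlin : ∀ {a b : ℕ} (T : EuclideanSpace ℝ (Fin a) →ₗ[ℝ] EuclideanSpace ℝ (Fin b)),
      Measurable T := fun T => T.continuous_of_finiteDimensional.measurable
  refine State.continuous_mk.measurable.comp (Measurable.prodMk ?_ (Measurable.prodMk ?_ ?_))
  · refine measurable_toLp_blocks fun i => ?_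
    refine (continuous_proj (hX.nonempty i) (hX.compact i).isClosed
      (hX.convex i)).measurable.comp ?_
    refine (measurable_block (hpr hw') i).fun_sub (Measurable.fun_const_smul (Measurable.fun_add ?_ ?_) _)
    · exact measurable_block (measurable_sampleGrad G hm hs hS hxt) i
    · exact (hlin _).comp (measurable_block hlt i)
  · refine measurable_toLp_blocks fun i => ?_
    refine (measurable_block (hau hw') i).fun_sub (Measurable.fun_const_smul
      (Finset.measurable_fun_sum _ fun j _ => Measurable.fun_const_smul (Measurable.fun_sub ?_ ?_) _) _)
    exacts [measurable_block hlt i, measurable_block hlt j]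
  · refine measurable_toLp_blocks fun i => ?_
    refine (continuous_proj (orthant_nonempty m) (isClosed_orthant m)
      (convex_orthant m)).measurable.comp ?_
    refine ((measurable_block (hdu hw') i).fun_add (Measurable.fun_const_smul (Measurable.fun_sub ?_
      measurable_const) _)).fun_add (Measurable.fun_const_smul (Finset.measurable_fun_sum _ fun j _ =>
        Measurable.fun_const_smul (Measurable.fun_sub (Measurable.fun_sub ?_ ?_) (Measurable.fun_sub ?_ ?_)) _) _)
    · exact (hlin _).comp (measurable_block hxt i)
    exacts [measurable_block hzt i, measurable_block hzt j, measurable_block hlt i,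
      measurable_block hlt j]

/-- The σ-algebra on `Ξ` is arbitrary and only samples before `k` are involved, so the lemma also
applies with `info` at time `k`, giving adaptedness. -/
lemma measurable_sprgPair (hX : G.ConstraintAssumption)
    (hm : ∀ i, Measurable fun p : Profile n × EuclideanSpace ℝ (Fin d) => G.J i p.1 p.2)
    (hs : ∀ i x v, ContDiff ℝ 1 fun y => G.J i (replace x i y) v) {winit w0 : Ξ → State n m}
    (hwinit : Measurable winit) (hw0 : Measurable w0) (k : ℕ)
    (hS : ∀ j < k, ∀ i s, Measurable (S j i s)) :
    Measurable (sprgPair G W B S α ν τ winit w0 k) := by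
  induction k with
  | zero => exact hwinit.prodMk hw0
  | succ k ih =>
    have h := ih fun j hj => hS j (by omega)
    exact (measurable_snd.comp h).prodMk (measurable_sprgStep G hX hm hs (hS k (by omega))
      (measurable_fst.comp h) (measurable_snd.comp h))

end Measurability

/-! ### Almost sure summability and martingale convergence -/

section Martingale

variable {Ω E : Type*} {m0 : MeasurableSpace Ω} {P : Measure Ω}
  [NormedAddCommGroup E] [InnerProductSpace ℝ E]

lemma ae_summable_of_summable_integral {f : ℕ → Ω → ℝ} (hf : ∀ k, Integrable (f k) P)
    (h0 : ∀ k ω, 0 ≤ f k ω) (hs : Summable fun k => ∫ ω, f k ω ∂P) :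
    ∀ᵐ ω ∂P, Summable fun k => f k ω := by
  have h1 : ∫⁻ ω, ∑' k, ENNReal.ofReal (f k ω) ∂P ≠ ⊤ := by
    rw [lintegral_tsum fun k => (hf k).1.aemeasurable.ennreal_ofReal]
    simp_rw [← ofReal_integral_eq_lintegral_ofReal (hf _) (Eventually.of_forall (h0 _))]
    rw [← ENNReal.ofReal_tsum_of_nonneg (fun k => integral_nonneg (h0 k)) hs]
    exact ENNReal.ofReal_ne_top
  have h2 := ae_lt_top' (AEMeasurable.tsum fun k =>
    (hf k).1.aemeasurable.ennreal_ofReal) h1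
  filter_upwards [h2] with ω hω
  have := ENNReal.summable_toReal hω.ne
  simpa only [ENNReal.toReal_ofReal (h0 _ ω)] using this

/-- Sums of conditionally centred square integrable errors, tested against bounded predictable
vectors, converge almost surely when the variances are summable. -/
lemma ae_tendsto_sum_inner [IsProbabilityMeasure P] [CompleteSpace E] {𝓕 : ℕ → MeasurableSpace Ω} (hmono : Monotone 𝓕)
    (hle : ∀ k, 𝓕 k ≤ m0) {e v : ℕ → Ω → E} (he : ∀ k, StronglyMeasurable[𝓕 (k + 1)] (e k))
    (hv : ∀ k, StronglyMeasurable[𝓕 k] (v k)) {D : ℝ} (hD : ∀ k ω, ‖v k ω‖ ≤ D)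
    (hL2 : ∀ k, MemLp (e k) 2 P) (hc : ∀ k, P[e k | 𝓕 k] =ᵐ[P] 0)
    (hs : Summable fun k => ∫ ω, ‖e k ω‖ ^ 2 ∂P) :
    ∀ᵐ ω ∂P, ∃ c, Tendsto (fun k => ∑ j ∈ Finset.range k, ⟪e j ω, v j ω⟫) atTop (𝓝 c) := by
  let ℱ : Filtration ℕ m0 := ⟨𝓕, hmono, hle⟩
  let M : ℕ → Ω → ℝ := fun k ω => ∑ j ∈ Finset.range k, ⟪e j ω, v j ω⟫
  have hmeas : ∀ k, StronglyMeasurable[𝓕 (k + 1)] fun ω => ⟪e k ω, v k ω⟫ := fun k =>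
    (he k).inner ((hv k).mono (hmono k.le_succ))
  have hle2 : ∀ k ω, ‖⟪e k ω, v k ω⟫‖ ≤ D * ‖e k ω‖ := fun k ω => by
    refine (norm_inner_le_norm _ _).trans ?_
    rw [mul_comm]
    exact mul_le_mul_of_nonneg_right (hD k ω) (norm_nonneg _)
  have hmL2 : ∀ k, MemLp (fun ω => ⟪e k ω, v k ω⟫) 2 P := fun k =>
    (hL2 k).of_le_mul ((hmeas k).mono (hle _)).aestronglyMeasurable
      (Eventually.of_forall (hle2 k))
  have hML2 : ∀ k, MemLp (M k) 2 P := fun k => memLp_finsetSum _ fun j _ => hmL2 j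
  have hadp : ∀ k, StronglyMeasurable[𝓕 k] (M k) := fun k =>
    Finset.stronglyMeasurable_fun_sum _ fun j hj =>
      (hmeas j).mono (hmono (Finset.mem_range.1 hj))
  have hcz : ∀ k, P[fun ω => ⟪e k ω, v k ω⟫ | 𝓕 k] =ᵐ[P] 0 := fun k => by
    have h := condExp_bilin_of_stronglyMeasurable_right (μ := P) (innerSL ℝ (E := E)) (hv k)
      ((hmL2 k).integrable (by norm_num)) ((hL2 k).integrable (by norm_num))
    refine h.trans ?_
    filter_upwards [hc k] with ω hω
    simp [hω]
  have hsucc : ∀ k, M (k + 1) = M k + fun ω => ⟪e k ω, v k ω⟫ := fun k =>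
    funext fun ω => Finset.sum_range_succ _ _
  have hmart : Martingale M ℱ P := martingale_of_condExp_sub_eq_zero_nat hadp
    (fun k => (hML2 k).integrable (by norm_num)) fun k => by
      rw [hsucc, add_sub_cancel_left]; exact hcz k
  -- Increments are orthogonal to the past, so second moments add up without cross terms.
  have hcross : ∀ k, ∫ ω, M k ω * ⟪e k ω, v k ω⟫ ∂P = 0 := fun k => by
    change ∫ ω, (M k * fun ω => ⟪e k ω, v k ω⟫) ω ∂P = 0
    rw [← integral_condExp (hle k)]
    have h := condExp_mul_of_stronglyMeasurable_left (μ := P) (hadp k)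
      ((hML2 k).integrable_mul (hmL2 k)) ((hmL2 k).integrable (by norm_num))
    rw [integral_congr_ae (g := fun _ => (0 : ℝ)) (h.trans ?_), integral_zero]
    filter_upwards [hcz k] with ω hω
    simp [hω]
  have hsq : ∀ k, ∫ ω, M k ω ^ 2 ∂P ≤ D ^ 2 * ∑ j ∈ Finset.range k, ∫ ω, ‖e j ω‖ ^ 2 ∂P := by
    intro k
    induction k with
    | zero => simp [M]
    | succ k ih =>
      have h1 : ∀ ω, M (k + 1) ω ^ 2
          = M k ω ^ 2 + 2 * (M k ω * ⟪e k ω, v k ω⟫) + ⟪e k ω, v k ω⟫ ^ 2 := fun ω => by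
        rw [hsucc, Pi.add_apply]; ring
      have hi1 : Integrable (fun ω => M k ω ^ 2) P := (hML2 k).integrable_sq
      have hi2 : Integrable (fun ω => 2 * (M k ω * ⟪e k ω, v k ω⟫)) P :=
        ((hML2 k).integrable_mul (hmL2 k)).const_mul 2
      have hi3 : Integrable (fun ω => ⟪e k ω, v k ω⟫ ^ 2) P := (hmL2 k).integrable_sq
      have hi4 : Integrable (fun ω => ‖e k ω‖ ^ 2) P := (hL2 k).integrable_norm_pow two_ne_zero
      have hi12 : Integrable (fun ω => M k ω ^ 2 + 2 * (M k ω * ⟪e k ω, v k ω⟫)) P := hi1.add hi2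
      simp_rw [h1]
      rw [integral_add hi12 hi3, integral_add hi1 hi2, integral_const_mul, hcross,
        mul_zero, add_zero, Finset.sum_range_succ, mul_add]
      refine add_le_add ih ?_
      rw [← integral_const_mul]
      refine integral_mono hi3 (hi4.const_mul _) fun ω => ?_
      have := hle2 k ω
      calc ⟪e k ω, v k ω⟫ ^ 2 = ‖⟪e k ω, v k ω⟫‖ ^ 2 := by rw [Real.norm_eq_abs, sq_abs]
        _ ≤ (D * ‖e k ω‖) ^ 2 := by gcongr
        _ = _ := by ring
  obtain ⟨R, hR⟩ : ∃ R : ℝ≥0, (R : ℝ) = 1 + D ^ 2 * ∑' j, ∫ ω, ‖e j ω‖ ^ 2 ∂P :=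
    ⟨⟨_, add_nonneg zero_le_one (mul_nonneg (sq_nonneg _)
      (tsum_nonneg fun j => integral_nonneg fun ω => sq_nonneg _))⟩, rfl⟩
  -- Doob's theorem needs only an L¹ bound, which follows from the L² bound through `|M| ≤ 1 + M ^
  -- 2`.
  have hbdd : ∀ k, eLpNorm (M k) 1 P ≤ R := fun k => by
    have hi : Integrable (M k) P := (hML2 k).integrable (by norm_num)
    rw [eLpNorm_one_eq_lintegral_enorm, ← ofReal_integral_norm_eq_lintegral_enorm hi,
      ← ENNReal.ofReal_coe_nnreal]
    refine ENNReal.ofReal_le_ofReal ?_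
    rw [hR]
    calc ∫ ω, ‖M k ω‖ ∂P ≤ ∫ ω, (1 + M k ω ^ 2) ∂P := by
          refine integral_mono hi.norm ((integrable_const _).add (hML2 k).integrable_sq) fun ω => ?_
          have : ‖M k ω‖ ^ 2 = M k ω ^ 2 := by rw [Real.norm_eq_abs, sq_abs]
          simp only
          nlinarith [sq_nonneg (‖M k ω‖ - 1), norm_nonneg (M k ω)]
      _ = 1 + ∫ ω, M k ω ^ 2 ∂P := by
          rw [integral_add (integrable_const _) (hML2 k).integrable_sq]; simp
      _ ≤ _ := by
          gcongr
          refine (hsq k).trans ?_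
          gcongr
          exact hs.sum_le_tsum _ fun j _ => integral_nonneg fun ω => sq_nonneg _
  filter_upwards [hmart.submartingale.ae_tendsto_limitProcess hbdd] with ω hω
  exact ⟨_, hω⟩

end Martingale

/-! ### From the variational inequality to equilibria -/

section Equilibrium

/-- The gradient inequality for a convex function that is differentiable at a point of its domain. -/
lemma ConvexOn.add_fderiv_le {E : Type*} [NormedAddCommGroup E] [NormedSpace ℝ E] {Ω : Set E}
    {f : E → ℝ} (hf : ConvexOn ℝ Ω f) {x y : E} (hx : x ∈ Ω) (hy : y ∈ Ω)
    (hd : DifferentiableAt ℝ f x) : f x + fderiv ℝ f x (y - x) ≤ f y := by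
  have h := hd.hasFDerivAt.lim_real (y - x)
  have h2 : fderiv ℝ f x (y - x) ≤ f y - f x := by
    refine le_of_tendsto h ?_
    filter_upwards [eventually_ge_atTop 1] with c hc
    have hc0 : 0 < c := by linarith
    have h3 : x + c⁻¹ • (y - x) = (1 - c⁻¹) • x + c⁻¹ • y := by module
    have h4 := hf.2 hx hy (sub_nonneg.2 (inv_le_one_of_one_le₀ hc)) (inv_nonneg.2 hc0.le)
      (by ring)
    rw [← h3] at h4
    simp only [smul_eq_mul] at h4 ⊢
    calc c * (f (x + c⁻¹ • (y - x)) - f x) ≤ c * (((1 - c⁻¹) * f x + c⁻¹ * f y) - f x) := by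
          gcongr
      _ = f y - f x := by field_simp; ring
  linarith

variable {N : ℕ} {n : Fin N → ℕ} {m d : ℕ} (G : Game n m d) {Ξ : Type*} [MeasurableSpace Ξ]
  {P : Measure Ξ} {ξ : Ξ → EuclideanSpace ℝ (Fin d)}

/-- The gradient inequality is applied scenario by scenario and then integrated, so no derivative is
exchanged with the expectation. -/
lemma Game.cost_add_inner_le (hJ : G.CostAssumption P ξ) {x : Profile n} (hx : x ∈ G.localSet)
    (i : Fin N) {y : EuclideanSpace ℝ (Fin (n i))} (hy : y ∈ G.Ω i) :
    G.cost P ξ i x + ⟪G.pseudograd P ξ x i, y - x i⟫ ≤ G.cost P ξ i (replace x i y) := by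
  have hloc : replace x i y ∈ G.localSet := fun j => by
    by_cases h : j = i
    · subst h; rwa [replace_apply_self]
    · rw [replace_apply_ne _ h]; exact hx j
  have hpt : ∀ v, G.J i x v + ⟪y - x i, G.gradJ i x v⟫ ≤ G.J i (replace x i y) v := fun v => by
    have := ConvexOn.add_fderiv_le (hJ.convex_J i x hx v) (hx i) hy
      (((hJ.smooth_J i x v).differentiable (by norm_num)).differentiableAt)
    rwa [replace_self, ← inner_gradient_left, real_inner_comm] at this
  have hg := hJ.integrable_gradJ i x
  have h1 : ⟪G.pseudograd P ξ x i, y - x i⟫ = ∫ θ, ⟪y - x i, G.gradJ i x (ξ θ)⟫ ∂P := by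
    rw [integral_inner hg, real_inner_comm]; rfl
  have hi := hJ.integrable_J i x hx
  rw [h1, Game.cost, ← integral_add hi (hg.const_inner _)]
  exact integral_mono (hi.add (hg.const_inner _)) (hJ.integrable_J i _ hloc) fun θ => hpt (ξ θ)

/-- Solutions of the variational inequality are variational equilibria. -/
theorem Game.SolvesSVI.isVSGNE (hJ : G.CostAssumption P ξ) {x : Profile n}
    (hx : G.SolvesSVI P ξ x) : G.IsVSGNE P ξ x := by
  refine ⟨⟨hx.1, fun i y hy => ?_⟩, hx⟩
  -- A unilateral deviation allowed to agent `i` is feasible for the shared constraint, hence a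
  -- legitimate test point of the inequality.
  have hfeas : replace x i y ∈ G.feasible := by
    refine ⟨fun j => ?_, fun r => ?_⟩
    · by_cases h : j = i
      · subst h; rw [replace_apply_self]; exact hy.1
      · rw [replace_apply_ne _ h]; exact hx.1.1 j
    · have h1 := hy.2 r
      rw [← Finset.add_sum_erase _ _ (Finset.mem_univ i), replace_apply_self, PiLp.add_apply]
      have h2 : ∑ j ∈ Finset.univ.erase i, G.mulA j (replace x i y j)
          = ∑ j ∈ Finset.univ.erase i, G.mulA j (x j) :=
        Finset.sum_congr rfl fun j hj => by rw [replace_apply_ne _ (Finset.ne_of_mem_erase hj)]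
      rw [h2]
      linarith
  have h1 := hx.2 _ hfeas
  have h2 : ⟪G.pseudograd P ξ x, replace x i y - x⟫ = ⟪G.pseudograd P ξ x i, y - x i⟫ := by
    rw [PiLp.inner_apply, Finset.sum_eq_single i]
    · rw [PiLp.sub_apply, replace_apply_self]
    · intro j _ hj
      rw [PiLp.sub_apply, replace_apply_ne _ hj, sub_self, inner_zero_right]
    · simp
  have h3 := G.cost_add_inner_le hJ hx.1.1 i hy.1
  linarith

end Equilibrium

/-! ### The filtration of available information -/

section Information

variable {N : ℕ} {n : Fin N → ℕ} {m d : ℕ} {Ξ : Type*} {B : ℕ → ℕ}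
  {S : (k : ℕ) → Fin N → Fin (B k) → Ξ → EuclideanSpace ℝ (Fin d)} {winit w0 : Ξ → State n m}

lemma comap_sample_le_info {j k : ℕ} (h : j < k) (i : Fin N) (s : Fin (B j)) :
    MeasurableSpace.comap (S j i s) inferInstance ≤ info B S winit w0 k :=
  le_sup_of_le_right (le_iSup_of_le (⟨j, h⟩ : Fin k) (le_iSup_of_le i
    (le_iSup (fun s : Fin (B j) => MeasurableSpace.comap (S j i s) inferInstance) s)))

lemma info_mono : Monotone (info B S winit w0) := by
  intro k l h
  refine sup_le_sup_left (iSup_le fun j => iSup_le fun i => iSup_le fun s => ?_) _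
  exact le_iSup_of_le (⟨j, j.2.trans_le h⟩ : Fin l) (le_iSup_of_le i
    (le_iSup (fun s : Fin (B j) => MeasurableSpace.comap (S j i s) inferInstance) s))

lemma info_le [m0 : MeasurableSpace Ξ] (hwinit : Measurable winit) (hw0 : Measurable w0)
    (hS : ∀ k i s, Measurable (S k i s)) (k : ℕ) : info B S winit w0 k ≤ m0 :=
  sup_le (sup_le hwinit.comap_le hw0.comap_le)
    (iSup_le fun j => iSup_le fun i => iSup_le fun s => (hS j i s).comap_le)

lemma measurable_sprgPair_info (G : Game n m d) {W : Matrix (Fin N) (Fin N) ℝ}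
    {α ν τ : Fin N → ℝ} (hX : G.ConstraintAssumption)
    (hm : ∀ i, Measurable fun p : Profile n × EuclideanSpace ℝ (Fin d) => G.J i p.1 p.2)
    (hs : ∀ i x v, ContDiff ℝ 1 fun y => G.J i (replace x i y) v) (k : ℕ) :
    Measurable[info B S winit w0 k] (sprgPair G W B S α ν τ winit w0 k) :=
  @measurable_sprgPair N n m d G W α ν τ Ξ (info B S winit w0 k) B S hX hm hs winit w0
    (Measurable.of_comap_le (le_sup_of_le_left le_sup_left))
    (Measurable.of_comap_le (le_sup_of_le_left le_sup_right)) k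
    fun _ hj i s => Measurable.of_comap_le (comap_sample_le_info hj i s)

end Information

/-! ### Uniform bounds, summable variances and the conclusion -/

lemma Game.exists_norm_le {N : ℕ} {n : Fin N → ℕ} {m d : ℕ} {G : Game n m d}
    (hX : G.ConstraintAssumption) : ∃ D, ∀ x ∈ G.localSet, ‖x‖ ≤ D := by
  choose D hD using fun i => (hX.compact i).isBounded.exists_norm_le
  refine ⟨√(∑ i, D i ^ 2), fun x hx => Real.le_sqrt_of_sq_le ?_⟩
  rw [PiLp.norm_sq_eq_of_L2]
  gcongr with i
  exact hD i _ (hx i)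

lemma BatchAssumption.summable {B : ℕ → ℕ} (hB : BatchAssumption B) :
    Summable fun k => 1 / (B k : ℝ) := by
  obtain ⟨c, k₀, a, hc, hk₀, ha, h⟩ := hB
  have h1 := ((Real.summable_one_div_nat_add_rpow k₀ (a + 1)).2 (by linarith)).mul_left (1 / c)
  refine Summable.of_nonneg_of_le (fun _ => by positivity) (fun k => ?_) h1
  have h2 : 0 < (k : ℝ) + k₀ := by positivity
  rw [abs_of_pos h2, one_div_mul_one_div]
  exact one_div_le_one_div_of_le (by positivity) (h k)

lemma ErrorAssumption.summable {N : ℕ} {n : Fin N → ℕ} {B : ℕ → ℕ} {Ξ : Type*}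
    [m0 : MeasurableSpace Ξ] {P : Measure Ξ} [IsProbabilityMeasure P] {ε : ℕ → Ξ → Profile n}
    {𝓕 : ℕ → MeasurableSpace Ξ} (hε : ErrorAssumption B P ε 𝓕) (hB : BatchAssumption B)
    (hle : ∀ k, 𝓕 k ≤ m0) : Summable fun k => ∫ θ, ‖ε k θ‖ ^ 2 ∂P := by
  obtain ⟨C, σ, hC, hσ, h⟩ := hε.variance
  refine Summable.of_nonneg_of_le (fun k => integral_nonneg fun _ => sq_nonneg _) (fun k => ?_)
    (hB.summable.mul_left (C * σ ^ 2))
  rw [← integral_condExp (hle k), mul_one_div]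
  calc _ ≤ ∫ _, C * σ ^ 2 / (B k : ℝ) ∂P :=
        integral_mono_ae integrable_condExp (integrable_const _) (h k)
    _ = _ := by simp

end SGNEP

theorem mainTheorem1 {N : ℕ} (n : Fin N → ℕ) (m d : ℕ) (G : Game n m d)
    (W : Matrix (Fin N) (Fin N) ℝ)
    {Ξ : Type*} [MeasurableSpace Ξ] (P : Measure Ξ) [IsProbabilityMeasure P]
    (ξ : Ξ → EuclideanSpace ℝ (Fin d)) (hξ : Measurable ξ)
    -- costs, constraints, communication graph
    (hJ : G.CostAssumption P ξ)
    (hX : G.ConstraintAssumption)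
    (hW : GraphAssumption W)
    -- the pseudogradient is monotone and Lipschitz continuous
    (hmono : ∀ x y, 0 ≤ ⟪G.pseudograd P ξ x - G.pseudograd P ξ y, x - y⟫)
    (ℓF : ℝ) (hℓF : 0 < ℓF)
    (hlip : ∀ x y, ‖G.pseudograd P ξ x - G.pseudograd P ξ y‖ ≤ ℓF * ‖x - y‖)
    -- the variational inequality has a unique solution
    (huniq : ∃! x, G.SolvesSVI P ξ x)
    -- step sizes
    (α ν τ : Fin N → ℝ)
    (hα : ∀ i, 0 < α i ∧ α i * lipConst (extOp G W (G.pseudograd P ξ)) < √2 - 1)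
    (hν : ∀ i, 0 < ν i ∧ ν i * lipConst (extOp G W (G.pseudograd P ξ)) < √2 - 1)
    (hτ : ∀ i, 0 < τ i ∧ τ i * lipConst (extOp G W (G.pseudograd P ξ)) < √2 - 1)
    -- initial data
    (winit w0 : Ξ → State n m) (hwinit : Measurable winit) (hw0 : Measurable w0)
    (hx0 : ∀ θ i, (w0 θ).primal i ∈ G.Ω i) (hl0 : ∀ θ i, (w0 θ).dual i ∈ orthant m)
    -- batch sizes, samples and stochastic errors
    (B : ℕ → ℕ) (hB : BatchAssumption B)
    (S : (k : ℕ) → Fin N → Fin (B k) → Ξ → EuclideanSpace ℝ (Fin d))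
    (hS : SamplingAssumption B S P ξ)
    (hε : ErrorAssumption B P (sprgError G W B S P ξ α ν τ winit w0) (info B S winit w0)) :
    ∃ x : Profile n, G.IsVSGNE P ξ x ∧
      ∀ᵐ θ ∂P, Tendsto (fun k => sprgX G W B S α ν τ winit w0 k θ) atTop (𝓝 x) := by
  obtain ⟨x, hx, hxu⟩ := huniq
  refine ⟨x, hx.isVSGNE G hJ, ?_⟩
  have hle := info_le (B := B) (S := S) hwinit hw0 hS.measurable
  have hsum := hε.summable hB hle
  have hFc : Continuous (G.pseudograd P ξ) := by
    refine (LipschitzWith.of_dist_le_mul (K := ⟨ℓF, hℓF.le⟩) fun x y => ?_).continuous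
    rw [dist_eq_norm, dist_eq_norm]
    exact hlip x y
  have hpair := fun k => measurable_sprgPair_info (B := B) (S := S) (winit := winit) (w0 := w0)
    (W := W) (α := α) (ν := ν) (τ := τ) G hX hJ.measurable_J hJ.smooth_J k
  have hrefl : ∀ k, Measurable[info B S winit w0 k]
      (sprgReflected G W B S α ν τ winit w0 k) := fun k => by
    have h1 : Measurable fun q : State n m × State n m => q.1.primal :=
      State.continuous_primal.measurable.comp measurable_fst
    have h2 : Measurable fun q : State n m × State n m => q.2.primal :=
      State.continuous_primal.measurable.comp measurable_snd
    exact ((h2.const_smul (2 : ℝ)).sub h1).comp (hpair k)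
  have herr : ∀ k, Measurable[info B S winit w0 (k + 1)]
      (sprgError G W B S P ξ α ν τ winit w0 k) := fun k => by
    have h1 := (hrefl k).mono (info_mono k.le_succ) le_rfl
    have h2 := @measurable_sampleGrad N n m d G Ξ (info B S winit w0 (k + 1)) B S hJ.measurable_J
      hJ.smooth_J k (fun i s => Measurable.of_comap_le (comap_sample_le_info k.lt_succ_self i s))
      _ h1
    exact Measurable.sub h2 (hFc.measurable.comp h1)
  have hmem : ∀ k θ, (sprgPair G W B S α ν τ winit w0 k θ).2 ∈ G.stateSet := fun k θ => by
    rcases k with _ | k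
    · exact ⟨hx0 θ, hl0 θ⟩
    · exact sprgStep_mem G hX _ _
  obtain ⟨D, hD⟩ := Game.exists_norm_le hX
  have hbound : ∀ k θ, ‖sprgReflected G W B S α ν τ winit w0 (k + 1) θ - x‖ ≤ 2 * D + D + D := by
    intro k θ
    have h1 := hD _ (hmem (k + 1) θ).1
    have h2 := hD _ (hmem k θ).1
    have h3 := hD x hx.1.1
    have h4 : sprgReflected G W B S α ν τ winit w0 (k + 1) θ
        = (2 : ℝ) • (sprgPair G W B S α ν τ winit w0 (k + 1) θ).2.primal
          - (sprgPair G W B S α ν τ winit w0 k θ).2.primal := rfl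
    have h5 := norm_smul (2 : ℝ) (sprgPair G W B S α ν τ winit w0 (k + 1) θ).2.primal
    rw [Real.norm_ofNat] at h5
    rw [h4]
    refine (norm_sub_le _ _).trans (add_le_add ((norm_sub_le _ _).trans (add_le_add ?_ h2)) h3)
    rw [h5]
    exact mul_le_mul_of_nonneg_left h1 two_pos.le
  -- Time is shifted by one: the reflected point at time zero involves the arbitrary `winit` and may
  -- be unbounded, whereas from time one on both iterates lie in the compact local sets.
  have hmart := ae_tendsto_sum_inner (P := P) (𝓕 := fun k => info B S winit w0 (k + 1))
    (fun _ _ h => info_mono (Nat.succ_le_succ h)) (fun k => hle (k + 1))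
    (e := fun k => sprgError G W B S P ξ α ν τ winit w0 (k + 1))
    (v := fun k θ => sprgReflected G W B S α ν τ winit w0 (k + 1) θ - x)
    (fun k => (herr (k + 1)).stronglyMeasurable)
    (fun k => ((hrefl (k + 1)).sub_const x).stronglyMeasurable) hbound
    (fun k => hε.memLp (k + 1)) (fun k => hε.unbiased (k + 1)) ((summable_nat_add_iff 1).2 hsum)
  have hsumae := ae_summable_of_summable_integral
    (fun k => (hε.memLp k).integrable_norm_pow two_ne_zero) (fun _ _ => sq_nonneg _) hsum
  filter_upwards [hmart, hsumae] with θ h1 h2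
  obtain ⟨c, hc⟩ := h1
  -- The descent argument needs only a lower bound on the noise sums along the path, and convergence
  -- provides one.
  obtain ⟨r, hr⟩ := hc.bddBelow_range
  exact sprg_tendsto_of_errors G hX hW hmono hℓF.le hlip hα hν hτ hx.1 hx.2
    (fun x' h h' => hxu x' ⟨h, h'⟩) (p := fun k => sprgPair G W B S α ν τ winit w0 k θ)
    (Fh := fun k => sampleGrad G B S k θ) (fun _ => rfl) (hmem 0 θ)
    (xt := fun k => sprgReflected G W B S α ν τ winit w0 k θ)
    (ε := fun k => sprgError G W B S P ξ α ν τ winit w0 k θ) (fun _ => rfl) (fun _ => rfl)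
    (R := -r) (fun k => by rw [neg_neg]; exact hr ⟨k, rfl⟩) h2
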